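/- Write $\mathbb D=\{z\in\mathbb C:|z|<1\}$. For an open set $\Omega\subset\mathbb C^2$, the Bergman projection $\mathbf B_\Omega$ is the orthogonal projection of $L^2(\Omega)$ (Lebesgue measure) onto the subspace of square integrable holomorphic functions on $\Omega$. For an integer $k\ge 0$, $W^k(\Omega)$ is the Sobolev space of the $f\in L^2(\Omega)$ all of whose weak derivatives (in the four real coordinates) of order at most $k$ are in $L^2(\Omega)$, normed by the square root of the sum of the squared $L^2(\Omega)$ norms of these derivatives. $C^\infty(\overline\Omega)$ is the space of the smooth functions $f$ on $\Omega$ such that $$\sup_{z\in\Omega}\left|\frac{\partial^{\alpha+\beta}f}{\partial z^\alpha\partial\bar z^\beta}(z)\right|<\infty\quad\text{for all multi-indices }\alpha,\beta,$$ with the topology given by these suprema as seminorms. A pseudoconvex domain in $\mathbb C^2$ is a nonempty connected open set that has a continuous plurisubharmonic exhaustion function. We say that $\overline\Omega$ has a Stein neighborhood basis if for every open set $U\supset\overline\Omega$ there is a pseudoconvex domain $W$ such that $\overline\Omega\subset\subset W\subset\subset U$, where $A\subset\subset B$ means that the closure of $A$ is a compact subset of $B$. **Theorem.** Let $g$ be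 a nonconstant, nonvanishing, bounded holomorphic function on $\mathbb D$, and let $$\Omega_g=\{(z_1,z_2)\in\mathbb C^2 : z_1\in\mathbb D,\ |z_2|<|g(z_1)|\}.$$ 1. If $\mathbf B_{\Omega_g}$ is bounded from $W^k(\Omega_g)$ to itself for every integer $k\ge 0$, then $\overline{\Omega_g}$ has a Stein neighborhood basis. 2. If $\mathbf B_{\Omega_g}$ maps $C^\infty(\overline{\Omega_g})$ continuously to itself, then $\overline{\Omega_g}$ has a Stein neighborhood basis. -/

import Mathlib

open MeasureTheory Metric
open scoped ContDiff ENNReal NNReal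

noncomputable section

/-! ### Partial derivatives on `ℂ² = ℝ⁴`

`ℂ × ℂ` carries the product topology and the product Lebesgue measure. The four coordinate
directions belong to the real coordinates `(x₁, y₁, x₂, y₂)`, where `z₁ = x₁ + i y₁` and
`z₂ = x₂ + i y₂`. The derivatives in `z₁, z₂` and their conjugates are linear combinations, with
constant coefficients, of the real partial derivatives of the same order. -/

/-- The four real coordinate directions of `ℂ²`. -/
def coordDir : Fin 4 → ℂ × ℂ :=
  ![((1 : ℂ), (0 : ℂ)), (Complex.I, 0), (0, 1), (0, Complex.I)]

/-- The classical partial derivative `∂_{w 0} ⋯ ∂_{w (j-1)} f` of order `j`, at `z`. -/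
def partialDeriv {j : ℕ} (w : Fin j → Fin 4) (f : ℂ × ℂ → ℂ) (z : ℂ × ℂ) : ℂ :=
  iteratedFDeriv ℝ j f z (fun i => coordDir (w i))

/-! ### `L²` Sobolev spaces of integer order -/

/-- `v` is the weak derivative `∂_{w 0} ⋯ ∂_{w (j-1)} f` on the open set `Ω`. -/
def HasWeakDeriv (Ω : Set (ℂ × ℂ)) {j : ℕ} (w : Fin j → Fin 4) (f v : ℂ × ℂ → ℂ) : Prop :=
  LocallyIntegrableOn f Ω volume ∧ LocallyIntegrableOn v Ω volume ∧
    ∀ φ : ℂ × ℂ → ℂ, ContDiff ℝ ∞ φ → HasCompactSupport φ → tsupport φ ⊆ Ω →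
      ∫ z in Ω, f z * partialDeriv w φ z = (-1 : ℂ) ^ j * ∫ z in Ω, v z * φ z

open Classical in
/-- A chosen representative of the weak derivative (unique up to null sets in `Ω`); by convention
`0` if there is none. -/
def weakDeriv (Ω : Set (ℂ × ℂ)) {j : ℕ} (w : Fin j → Fin 4) (f : ℂ × ℂ → ℂ) : ℂ × ℂ → ℂ :=
  if h : ∃ v, HasWeakDeriv Ω w f v then h.choose else 0

/-- `f ∈ W^k(Ω)`: `f` is in `L²(Ω)` and has all weak derivatives of order at most `k`, and they
are in `L²(Ω)`. -/
def MemSobolev (Ω : Set (ℂ × ℂ)) (k : ℕ) (f : ℂ × ℂ → ℂ) : Prop :=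
  MemLp f 2 (volume.restrict Ω) ∧
    ∀ j ≤ k, ∀ w : Fin j → Fin 4,
      ∃ v : ℂ × ℂ → ℂ, HasWeakDeriv Ω w f v ∧ MemLp v 2 (volume.restrict Ω)

/-- The norm of `W^k(Ω)`: the square root of the sum of the squares of the `L²(Ω)` norms of the
weak derivatives of order at most `k`. -/
def sobolevNorm (Ω : Set (ℂ × ℂ)) (k : ℕ) (f : ℂ × ℂ → ℂ) : ℝ≥0∞ :=
  (∑ j ∈ Finset.range (k + 1), ∑ w : Fin j → Fin 4,
    eLpNorm (weakDeriv Ω w f) 2 (volume.restrict Ω) ^ 2) ^ (1 / 2 : ℝ)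

/-! ### The Bergman projection -/

/-- The Hilbert space `L²(Ω)`. -/
abbrev L2 (Ω : Set (ℂ × ℂ)) : Type := Lp ℂ 2 ((volume : Measure (ℂ × ℂ)).restrict Ω)

/-- The Bergman space: the classes in `L²(Ω)` of the functions holomorphic on `Ω`. -/
def bergmanSpace (Ω : Set (ℂ × ℂ)) : Submodule ℂ (L2 Ω) where
  carrier := {f | ∃ F : ℂ × ℂ → ℂ, DifferentiableOn ℂ F Ω ∧ f =ᵐ[volume.restrict Ω] F}
  zero_mem' := ⟨0, differentiableOn_const 0, Lp.coeFn_zero ℂ 2 _⟩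
  add_mem' := by
    rintro f₁ f₂ ⟨F₁, h₁, e₁⟩ ⟨F₂, h₂, e₂⟩
    exact ⟨F₁ + F₂, h₁.add h₂, (Lp.coeFn_add f₁ f₂).trans (e₁.add e₂)⟩
  smul_mem' := by
    rintro c f ⟨F, h, e⟩
    exact ⟨c • F, h.const_smul c, (Lp.coeFn_smul c f).trans (e.const_smul c)⟩

/-- The Bergman projection: the orthogonal projection of `L²(Ω)` onto the Bergman space. For open
`Ω` the Bergman space is closed, so that taking its closure changes nothing; the closure is only
written in order that the projection is defined without a proof of this. -/
def bergmanProjection (Ω : Set (ℂ × ℂ)) : L2 Ω →L[ℂ] L2 Ω :=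
  (bergmanSpace Ω).topologicalClosure.starProjection

/-- The Bergman projection maps `W^k(Ω)` to itself and is bounded there. -/
def BergmanBoundedOnSobolev (Ω : Set (ℂ × ℂ)) (k : ℕ) : Prop :=
  ∃ C : ℝ≥0, ∀ f : L2 Ω, MemSobolev Ω k f →
    MemSobolev Ω k (bergmanProjection Ω f) ∧
      sobolevNorm Ω k (bergmanProjection Ω f) ≤ C * sobolevNorm Ω k f

/-! ### Functions all of whose derivatives are bounded -/

/-- `f ∈ C^∞(closure of Ω)`: `f` is smooth on the open set `Ω` and each of its partial derivatives
(of order `0, 1, 2, …`) is bounded on `Ω`. -/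
def MemSmoothBounded (Ω : Set (ℂ × ℂ)) (f : ℂ × ℂ → ℂ) : Prop :=
  ContDiffOn ℝ ∞ f Ω ∧
    ∀ (j : ℕ) (w : Fin j → Fin 4), ∃ M : ℝ, ∀ z ∈ Ω, ‖partialDeriv w f z‖ ≤ M

/-- The seminorms of `C^∞(closure of Ω)`: the supremum over `Ω` of the partial derivatives of
order at most `k`. -/
def smoothSeminorm (Ω : Set (ℂ × ℂ)) (k : ℕ) (f : ℂ × ℂ → ℂ) : ℝ≥0∞ :=
  ⨆ (j : ℕ) (_ : j ≤ k) (w : Fin j → Fin 4) (z ∈ Ω), ‖partialDeriv w f z‖ₑ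

/-- The Bergman projection maps `C^∞(closure of Ω)` to itself, continuously for the topology given
by the seminorms. Elements of `C^∞(closure of Ω)` are compared with their classes in `L²(Ω)`. -/
def BergmanContinuousOnSmooth (Ω : Set (ℂ × ℂ)) : Prop :=
  (∀ (f : ℂ × ℂ → ℂ) (f₂ : L2 Ω), MemSmoothBounded Ω f → f₂ =ᵐ[volume.restrict Ω] f →
    ∃ F : ℂ × ℂ → ℂ, MemSmoothBounded Ω F ∧ bergmanProjection Ω f₂ =ᵐ[volume.restrict Ω] F) ∧
  ∀ k : ℕ, ∃ (m : ℕ) (C : ℝ≥0), ∀ (f F : ℂ × ℂ → ℂ) (f₂ : L2 Ω),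
    MemSmoothBounded Ω f → MemSmoothBounded Ω F → f₂ =ᵐ[volume.restrict Ω] f →
    bergmanProjection Ω f₂ =ᵐ[volume.restrict Ω] F →
      smoothSeminorm Ω k F ≤ C * smoothSeminorm Ω m f

/-! ### Pseudoconvex domains and Stein neighborhood bases -/

/-- `u` is a continuous plurisubharmonic function on the open set `W`: on each closed disc
`{a + ζ b : |ζ| ≤ 1}` in a complex line that lies in `W`, the value at the centre is at most the
mean over the boundary circle. -/
def IsContPlurisubharmonicOn (u : ℂ × ℂ → ℝ) (W : Set (ℂ × ℂ)) : Prop :=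
  ContinuousOn u W ∧
    ∀ a b : ℂ × ℂ, (∀ ζ : ℂ, ‖ζ‖ ≤ 1 → a + ζ • b ∈ W) →
      u a ≤ Real.circleAverage (fun ζ : ℂ => u (a + ζ • b)) 0 1

/-- A pseudoconvex domain in `ℂ²`: a nonempty connected open set with a continuous
plurisubharmonic exhaustion function. -/
def IsPseudoconvexDomain (W : Set (ℂ × ℂ)) : Prop :=
  IsOpen W ∧ IsConnected W ∧
    ∃ u : ℂ × ℂ → ℝ, IsContPlurisubharmonicOn u W ∧ ∀ c : ℝ, IsCompact {z ∈ W | u z ≤ c}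

/-- `A ⊂⊂ B`: the closure of `A` is a compact subset of `B`. -/
def CompactlyContained (A B : Set (ℂ × ℂ)) : Prop :=
  IsCompact (closure A) ∧ closure A ⊆ B

/-- The closed set `K` has a Stein neighborhood basis. -/
def HasSteinNeighborhoodBasis (K : Set (ℂ × ℂ)) : Prop :=
  ∀ U : Set (ℂ × ℂ), IsOpen U → K ⊆ U →
    ∃ W : Set (ℂ × ℂ), IsPseudoconvexDomain W ∧ CompactlyContained K W ∧ CompactlyContained W U

/-- The complete Hartogs domain `{(z₁, z₂) : |z₁| < 1, |z₂| < |g(z₁)|}`. -/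
def hartogsDomain (g : ℂ → ℂ) : Set (ℂ × ℂ) :=
  {z | z.1 ∈ ball (0 : ℂ) 1 ∧ ‖z.2‖ < ‖g z.1‖}

end

/-! Everything is decided by one function, `hartogsFun`, that is h = z₂ / g(z₁)². Substituting z₂ =
g(z₁) t, with Jacobian |g|², turns the pairing of h with a holomorphic G into the integral of
conj(t) g(z₁) G(z₁, g(z₁) t), whose integrand is holomorphic in z₁. By the mean value property, a
radial weight in z₁ of mean zero then makes the pairing vanish. So if χ is a radial cutoff of mean c
≠ 0, the projection of χ h is c h (`bergmanProjection_radial_hartogsFun`). The input χ h is smooth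
up to the boundary, because χ vanishes near |z₁| = 1; regularity of the projection therefore forces
regularity of h itself.

Put u = g⁻². Since ∂₁ᵃ∂₂ h = u⁽ᵃ⁾(z₁), membership of h in W⁴ gives u⁽ᵃ⁾ g ∈ L²(𝔻) for a ≤ 3. The
product of the cases a = 3 and a = 0 is u‴ u g² = u‴, which is thus in L¹(𝔻). The Taylor
coefficients of u are then absolutely summable, and u extends continuously to the closed disc
(`exists_continuousOn_extension_of_integrableOn`). As g is bounded, |u| is bounded below, so |g| =
|u|^(-1/2) extends to a continuous positive function on the closed disc.

For such g the slightly larger domains |z₁| < R, |z₂| < (1 + ε)|g(z₁/R)| are pseudoconvex and shrink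
to the closure (`hasSteinNeighborhoodBasis_of_continuous_extension`). -/

/-! ### Pseudoconvexity of Hartogs domains with nonvanishing holomorphic radius function -/

/-- The function `(1 - |q|²)⁻¹` is subharmonic for holomorphic `q` with values in the disc. -/
theorem inv_one_sub_norm_sq_le_circleAverage {q : ℂ → ℂ} (hq : DiffContOnCl ℂ q (ball 0 1))
    (h1 : ∀ ζ ∈ closedBall (0 : ℂ) 1, ‖q ζ‖ < 1) :
    (1 - ‖q 0‖ ^ 2)⁻¹ ≤ Real.circleAverage (fun ζ => (1 - ‖q ζ‖ ^ 2)⁻¹) 0 1 := by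
  have hcont : ContinuousOn q (closedBall 0 1) := by
    have := hq.continuousOn
    rwa [closure_ball _ one_ne_zero] at this
  have hpos : ∀ ζ ∈ closedBall (0 : ℂ) 1, 0 < 1 - ‖q ζ‖ ^ 2 := fun ζ hζ => by
    have := h1 ζ hζ
    nlinarith [norm_nonneg (q ζ)]
  have hsph : sphere (0 : ℂ) |1| ⊆ closedBall 0 1 := by
    rw [abs_one]; exact sphere_subset_closedBall
  set p := q 0 with hp
  have hp0 : 0 < 1 - ‖p‖ ^ 2 := hpos 0 (by simp)
  -- The real part of `L` is the first-order Taylor polynomial at p of w ↦ (1 - |w|²)⁻¹, evaluated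
  -- at q(ζ). By convexity it is a lower bound, and since `L` is holomorphic its circle mean is its
  -- value at 0.
  set L : ℂ → ℂ := fun ζ => ((1 - ‖p‖ ^ 2)⁻¹ : ℝ) +
    (2 * (((1 - ‖p‖ ^ 2) ^ 2)⁻¹ : ℝ)) * ((q ζ - p) * (starRingEnd ℂ) p) with hL
  have hLd : DiffContOnCl ℂ L (ball 0 |1|) := by
    rw [abs_one]
    refine DiffContOnCl.add diffContOnCl_const ?_
    refine DiffContOnCl.smul (𝕜' := ℂ) diffContOnCl_const ?_
    exact DiffContOnCl.smul (𝕜' := ℂ) (hq.sub diffContOnCl_const) diffContOnCl_const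
  have havg := hLd.circleAverage
  have hLcont : ContinuousOn L (sphere 0 |1|) := by
    have := hLd.continuousOn
    rw [abs_one, closure_ball _ one_ne_zero] at this
    exact this.mono hsph
  have hLint : CircleIntegrable L 0 1 := hLcont.circleIntegrable'
  have hre : Real.circleAverage (fun ζ => (L ζ).re) 0 1 = (1 - ‖p‖ ^ 2)⁻¹ := by
    have h := Complex.reCLM.circleAverage_comp_comm hLint
    have h2 : (⇑Complex.reCLM ∘ L) = fun ζ => (L ζ).re := rfl
    rw [h2] at h
    have hL0 : L 0 = (((1 - ‖p‖ ^ 2)⁻¹ : ℝ) : ℂ) := by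
      simp only [hL, ← hp, sub_self, zero_mul, mul_zero, add_zero]
    rw [h, havg, hL0, Complex.reCLM_apply, Complex.ofReal_re]
  rw [← hre]
  refine Real.circleAverage_mono ?_ ?_ ?_
  · exact ContinuousOn.circleIntegrable' (Complex.continuous_re.comp_continuousOn hLcont)
  · refine ContinuousOn.circleIntegrable' (ContinuousOn.inv₀ ?_ ?_)
    · exact continuousOn_const.sub ((hcont.mono hsph).norm.pow 2)
    · exact fun ζ hζ => (hpos ζ (hsph hζ)).ne'
  · intro ζ hζ
    have h2 := hpos ζ (hsph hζ)
    have e1 : (L ζ).re = (1 - ‖p‖ ^ 2)⁻¹ +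
        2 * ((1 - ‖p‖ ^ 2) ^ 2)⁻¹ * ((q ζ - p) * (starRingEnd ℂ) p).re := by
      have : L ζ = (((1 - ‖p‖ ^ 2)⁻¹ : ℝ) : ℂ) +
        ((2 * ((1 - ‖p‖ ^ 2) ^ 2)⁻¹ : ℝ) : ℂ) * ((q ζ - p) * (starRingEnd ℂ) p) := by
        simp [hL]
      rw [this, Complex.add_re, Complex.ofReal_re, Complex.re_ofReal_mul]
    -- The difference of the two sides is |q(ζ) - p|².
    have e2 : 2 * ((q ζ - p) * (starRingEnd ℂ) p).re ≤ ‖q ζ‖ ^ 2 - ‖p‖ ^ 2 := by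
      rw [← Complex.normSq_eq_norm_sq, ← Complex.normSq_eq_norm_sq, Complex.normSq_apply,
        Complex.normSq_apply]
      simp only [Complex.mul_re, Complex.sub_re, Complex.conj_re, Complex.sub_im, Complex.conj_im]
      nlinarith [sq_nonneg ((q ζ).re - p.re), sq_nonneg ((q ζ).im - p.im)]
    show (L ζ).re ≤ (1 - ‖q ζ‖ ^ 2)⁻¹
    rw [e1]
    set x := 1 - ‖p‖ ^ 2
    set y := 1 - ‖q ζ‖ ^ 2
    have e3 : 2 * (x ^ 2)⁻¹ * ((q ζ - p) * (starRingEnd ℂ) p).re ≤ (x ^ 2)⁻¹ * (x - y) := by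
      have : 0 < (x ^ 2)⁻¹ := by positivity
      have e4 : x - y = ‖q ζ‖ ^ 2 - ‖p‖ ^ 2 := by simp only [x, y]; ring
      rw [e4]; nlinarith
    have e5 : y⁻¹ - (x⁻¹ + (x ^ 2)⁻¹ * (x - y)) = (x - y) ^ 2 * (x ^ 2 * y)⁻¹ := by
      field_simp; ring
    have e6 : 0 ≤ (x - y) ^ 2 * (x ^ 2 * y)⁻¹ := by positivity
    linarith

/-- The Hartogs domain over the disc of radius `R`. -/
theorem isPseudoconvexDomain_hartogs {R : ℝ} (hR : 0 < R) {G : ℂ → ℂ}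
    (hG : DifferentiableOn ℂ G (ball 0 R)) (hG0 : ∀ z ∈ ball (0 : ℂ) R, G z ≠ 0) :
    IsPseudoconvexDomain {z : ℂ × ℂ | z.1 ∈ ball (0 : ℂ) R ∧ ‖z.2‖ < ‖G z.1‖} := by
  set W := {z : ℂ × ℂ | z.1 ∈ ball (0 : ℂ) R ∧ ‖z.2‖ < ‖G z.1‖} with hW
  have hRc : (R : ℂ) ≠ 0 := by exact_mod_cast hR.ne'
  have hGc : ContinuousOn (fun z : ℂ × ℂ => G z.1) (Prod.fst ⁻¹' ball (0 : ℂ) R) :=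
    hG.continuousOn.comp continuous_fst.continuousOn fun z hz => hz
  have hopen1 : IsOpen (Prod.fst ⁻¹' ball (0 : ℂ) R : Set (ℂ × ℂ)) :=
    isOpen_ball.preimage continuous_fst
  have hWopen : IsOpen W := by
    have : IsOpen ((Prod.fst ⁻¹' ball (0 : ℂ) R : Set (ℂ × ℂ)) ∩
        (fun z : ℂ × ℂ => ‖G z.1‖ - ‖z.2‖) ⁻¹' Set.Ioi 0) :=
      (hGc.norm.sub continuous_snd.norm.continuousOn).isOpen_inter_preimage hopen1 isOpen_Ioi
    convert this using 1
    ext z; simp [hW]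
  -- `Φ` maps the bidisc biholomorphically onto `W`, with inverse (`T1`, `T2`). The exhaustion is
  -- the pullback of (1 - |a|²)⁻¹ + (1 - |t|²)⁻¹ from the bidisc.
  set Φ : ℂ × ℂ → ℂ × ℂ := fun p => (R * p.1, G (R * p.1) * p.2) with hΦ
  have hmaps : ∀ a ∈ ball (0 : ℂ) 1, (R : ℂ) * a ∈ ball (0 : ℂ) R := fun a ha => by
    rw [mem_ball_zero_iff] at *
    rw [norm_mul, Complex.norm_real, Real.norm_of_nonneg hR.le]
    nlinarith
  have hΦc : ContinuousOn Φ (ball 0 1 ×ˢ ball 0 1) := by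
    refine ContinuousOn.prodMk (by fun_prop) (ContinuousOn.mul ?_ (by fun_prop))
    exact hG.continuousOn.comp (by fun_prop) fun p hp => hmaps _ hp.1
  have hΦW : ∀ p ∈ ball (0 : ℂ) 1 ×ˢ ball (0 : ℂ) 1, Φ p ∈ W := by
    rintro ⟨a, t⟩ ⟨ha, ht⟩
    refine ⟨hmaps a ha, ?_⟩
    have h1 : 0 < ‖G (R * a)‖ := norm_pos_iff.2 (hG0 _ (hmaps a ha))
    simp only [hΦ, norm_mul]
    have : ‖t‖ < 1 := by simpa using ht
    nlinarith
  set T1 : ℂ × ℂ → ℂ := fun z => z.1 / R with hT1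
  set T2 : ℂ × ℂ → ℂ := fun z => z.2 / G z.1 with hT2
  have hT1W : ∀ z ∈ W, ‖T1 z‖ < 1 := fun z hz => by
    have := hz.1
    rw [mem_ball_zero_iff] at this
    simp only [hT1, norm_div, Complex.norm_real, Real.norm_of_nonneg hR.le]
    rwa [div_lt_one hR]
  have hT2W : ∀ z ∈ W, ‖T2 z‖ < 1 := fun z hz => by
    simp only [hT2, norm_div]
    rw [div_lt_one (norm_pos_iff.2 (hG0 _ hz.1))]
    exact hz.2
  have hinv : ∀ z ∈ W, Φ (T1 z, T2 z) = z := fun z hz => by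
    have h0 := hG0 _ hz.1
    simp only [hΦ, hT1, hT2]
    rw [mul_div_cancel₀ _ hRc]
    ext <;> simp
    field_simp
  have hT1Φ : ∀ p, T1 (Φ p) = p.1 := fun p => by
    simp only [hT1, hΦ]; field_simp
  have hT2Φ : ∀ p ∈ ball (0 : ℂ) 1 ×ˢ ball (0 : ℂ) 1, T2 (Φ p) = p.2 := fun p hp => by
    have h0 := hG0 _ (hmaps p.1 hp.1)
    simp only [hT2, hΦ]; field_simp
  have hWimg : W = Φ '' (ball (0 : ℂ) 1 ×ˢ ball (0 : ℂ) 1) := by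
    ext z
    refine ⟨fun hz => ⟨(T1 z, T2 z), ⟨?_, ?_⟩, hinv z hz⟩, ?_⟩
    · simpa using hT1W z hz
    · simpa using hT2W z hz
    · rintro ⟨p, hp, rfl⟩; exact hΦW p hp
  have hcT1 : ContinuousOn T1 W := by fun_prop
  have hcT2 : ContinuousOn T2 W :=
    continuous_snd.continuousOn.div (hGc.mono fun z hz => hz.1) fun z hz => hG0 _ hz.1
  have hpos : ∀ w : ℂ, ‖w‖ < 1 → 0 < 1 - ‖w‖ ^ 2 := fun w hw => by
    nlinarith [norm_nonneg w]
  refine ⟨hWopen, ?_, fun z => (1 - ‖T1 z‖ ^ 2)⁻¹ + (1 - ‖T2 z‖ ^ 2)⁻¹, ⟨?_, ?_⟩, ?_⟩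
  · rw [hWimg]
    refine IsConnected.image ⟨⟨(0, 0), by simp⟩, ?_⟩ _ hΦc
    exact ((convex_ball _ _).prod (convex_ball _ _)).isPreconnected
  · refine ContinuousOn.add ?_ ?_
    · exact (continuousOn_const.sub (hcT1.norm.pow 2)).inv₀ fun z hz => (hpos _ (hT1W z hz)).ne'
    · exact (continuousOn_const.sub (hcT2.norm.pow 2)).inv₀ fun z hz => (hpos _ (hT2W z hz)).ne'
  · intro a b hab
    have hline : Continuous fun ζ : ℂ => a + ζ • b := by fun_prop
    have hcl : ∀ ζ ∈ closedBall (0 : ℂ) 1, a + ζ • b ∈ W := fun ζ hζ => hab ζ (by simpa using hζ)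
    have hd1 : DiffContOnCl ℂ (fun ζ : ℂ => T1 (a + ζ • b)) (ball 0 1) := by
      refine DifferentiableOn.diffContOnCl ?_
      simp only [hT1]
      fun_prop
    have hd2 : DiffContOnCl ℂ (fun ζ : ℂ => T2 (a + ζ • b)) (ball 0 1) := by
      refine DifferentiableOn.diffContOnCl ?_
      rw [closure_ball _ one_ne_zero]
      simp only [hT2]
      refine DifferentiableOn.div (by fun_prop) ?_ fun ζ hζ => hG0 _ (hcl ζ hζ).1
      exact hG.comp (f := fun ζ : ℂ => (a + ζ • b).1) (by fun_prop) fun ζ hζ => (hcl ζ hζ).1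
    have i1 := inv_one_sub_norm_sq_le_circleAverage hd1 fun ζ hζ => hT1W _ (hcl ζ hζ)
    have i2 := inv_one_sub_norm_sq_le_circleAverage hd2 fun ζ hζ => hT2W _ (hcl ζ hζ)
    have hsph : ∀ ζ ∈ sphere (0 : ℂ) |1|, a + ζ • b ∈ W := fun ζ hζ => by
      rw [abs_one] at hζ; exact hcl ζ (sphere_subset_closedBall hζ)
    have c1 : CircleIntegrable (fun ζ : ℂ => (1 - ‖T1 (a + ζ • b)‖ ^ 2)⁻¹) 0 1 := by
      refine ContinuousOn.circleIntegrable' (ContinuousOn.inv₀ ?_ ?_)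
      · exact continuousOn_const.sub ((hcT1.comp hline.continuousOn hsph).norm.pow 2)
      · exact fun ζ hζ => (hpos _ (hT1W _ (hsph ζ hζ))).ne'
    have c2 : CircleIntegrable (fun ζ : ℂ => (1 - ‖T2 (a + ζ • b)‖ ^ 2)⁻¹) 0 1 := by
      refine ContinuousOn.circleIntegrable' (ContinuousOn.inv₀ ?_ ?_)
      · exact continuousOn_const.sub ((hcT2.comp hline.continuousOn hsph).norm.pow 2)
      · exact fun ζ hζ => (hpos _ (hT2W _ (hsph ζ hζ))).ne'
    have hs := Real.circleAverage_add c1 c2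
    simp only [zero_smul, add_zero] at i1 i2
    refine (add_le_add i1 i2).trans ?_
    rw [← hs]
    rfl
  · intro c
    -- Each summand of the exhaustion is positive, so a bound c on the sum bounds both and keeps
    -- both coordinates in a disc of radius ρ < 1. Replacing c by max c 1 keeps the square root
    -- meaningful for small c.
    obtain ⟨ρ, hρ0, hρ1, hρ⟩ : ∃ ρ : ℝ, 0 ≤ ρ ∧ ρ < 1 ∧
        ∀ w : ℂ, ‖w‖ < 1 → (1 - ‖w‖ ^ 2)⁻¹ ≤ c → ‖w‖ ≤ ρ := by
      set d := max c 1
      have hd : 1 ≤ d := le_max_right _ _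
      have hd' : 0 < d⁻¹ := by positivity
      have hd1 : d⁻¹ ≤ 1 := inv_le_one_of_one_le₀ hd
      refine ⟨√(1 - d⁻¹), Real.sqrt_nonneg _, ?_, fun w hw hwc => ?_⟩
      · rw [Real.sqrt_lt' one_pos]; linarith
      · refine Real.le_sqrt_of_sq_le ?_
        have h3 : (1 - ‖w‖ ^ 2)⁻¹ ≤ d := hwc.trans (le_max_left _ _)
        have := inv_anti₀ (inv_pos.2 (hpos w hw)) h3
        rw [inv_inv] at this
        linarith
    have hsub : closedBall (0 : ℂ) ρ ×ˢ closedBall (0 : ℂ) ρ ⊆ ball (0 : ℂ) 1 ×ˢ ball (0 : ℂ) 1 :=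
      Set.prod_mono (closedBall_subset_ball hρ1) (closedBall_subset_ball hρ1)
    set v : ℂ × ℂ → ℝ := fun p => (1 - ‖p.1‖ ^ 2)⁻¹ + (1 - ‖p.2‖ ^ 2)⁻¹ with hv
    have hvc : ContinuousOn v (closedBall (0 : ℂ) ρ ×ˢ closedBall (0 : ℂ) ρ) := by
      refine ContinuousOn.add (ContinuousOn.inv₀ (by fun_prop) ?_)
        (ContinuousOn.inv₀ (by fun_prop) ?_)
      · exact fun p hp => (hpos _ (by simpa using (hsub hp).1)).ne'
      · exact fun p hp => (hpos _ (by simpa using (hsub hp).2)).ne'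
    have hK : IsCompact ((closedBall (0 : ℂ) ρ ×ˢ closedBall (0 : ℂ) ρ) ∩ v ⁻¹' Set.Iic c) := by
      refine ((isCompact_closedBall _ _).prod (isCompact_closedBall _ _)).of_isClosed_subset ?_
        Set.inter_subset_left
      exact hvc.preimage_isClosed_of_isClosed (isClosed_closedBall.prod isClosed_closedBall)
        isClosed_Iic
    convert hK.image_of_continuousOn (hΦc.mono (Set.inter_subset_left.trans hsub)) using 1
    ext z
    constructor
    · rintro ⟨hz, hzc⟩
      have p1 := inv_pos.2 (hpos _ (hT1W z hz))
      have p2 := inv_pos.2 (hpos _ (hT2W z hz))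
      refine ⟨(T1 z, T2 z), ⟨⟨?_, ?_⟩, hzc⟩, hinv z hz⟩
      · simpa using hρ _ (hT1W z hz) (by linarith)
      · simpa using hρ _ (hT2W z hz) (by linarith)
    · rintro ⟨p, ⟨hp, hpc⟩, rfl⟩
      refine ⟨hΦW p (hsub hp), ?_⟩
      show (1 - ‖T1 (Φ p)‖ ^ 2)⁻¹ + (1 - ‖T2 (Φ p)‖ ^ 2)⁻¹ ≤ c
      rw [hT1Φ, hT2Φ p (hsub hp)]
      exact hpc

/-! ### Stein neighborhoods from a continuous positive boundary extension -/

/-- A Hartogs domain over the unit disc whose radius function extends to a continuous positive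
function on the closed disc has a Stein neighborhood basis. -/
theorem hasSteinNeighborhoodBasis_of_continuous_extension {g : ℂ → ℂ}
    (hg : DifferentiableOn ℂ g (ball 0 1)) (hg0 : ∀ z ∈ ball (0 : ℂ) 1, g z ≠ 0)
    {ψ : ℂ → ℝ} (hψc : ContinuousOn ψ (closedBall 0 1)) (hψ0 : ∀ z ∈ closedBall (0 : ℂ) 1, 0 < ψ z)
    (hψ : ∀ z ∈ ball (0 : ℂ) 1, ψ z = ‖g z‖) :
    HasSteinNeighborhoodBasis (closure (hartogsDomain g)) := by
  set Q : Set (ℂ × ℂ) := closedBall 0 1 ×ˢ closedBall 0 1 with hQ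
  have hQc : IsCompact Q := (isCompact_closedBall _ _).prod (isCompact_closedBall _ _)
  -- Only |g| matters for the shape of the domain, so the modulus ψ serves as the fibre radius:
  -- unlike g, it is continuous on the closed disc.
  set Φ : ℂ × ℂ → ℂ × ℂ := fun p => (p.1, ψ p.1 * p.2) with hΦ
  have hΦc : ContinuousOn Φ Q := by
    refine ContinuousOn.prodMk (by fun_prop) (ContinuousOn.mul ?_ (by fun_prop))
    exact Complex.continuous_ofReal.comp_continuousOn
      (hψc.comp continuous_fst.continuousOn fun p hp => hp.1)
  have hKc : IsCompact (Φ '' Q) := hQc.image_of_continuousOn hΦc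
  have hΩ : Φ '' (ball 0 1 ×ˢ ball 0 1) = hartogsDomain g := by
    ext z
    constructor
    · rintro ⟨p, hp, rfl⟩
      refine ⟨hp.1, ?_⟩
      have h1 := hψ0 _ (ball_subset_closedBall hp.1)
      have h2 : ‖p.2‖ < 1 := by simpa using hp.2
      simp only [hΦ, norm_mul, Complex.norm_real, Real.norm_of_nonneg h1.le]
      rw [← hψ _ hp.1]
      nlinarith
    · rintro ⟨hz1, hz2⟩
      have h1 := hψ0 _ (ball_subset_closedBall hz1)
      have h1' : (ψ z.1 : ℂ) ≠ 0 := by exact_mod_cast h1.ne'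
      refine ⟨(z.1, z.2 / ψ z.1), ⟨hz1, ?_⟩, ?_⟩
      · simp only [mem_ball_zero_iff, norm_div, Complex.norm_real, Real.norm_of_nonneg h1.le]
        rw [div_lt_one h1, hψ _ hz1]; exact hz2
      · ext
        · simp [hΦ]
        · simp only [hΦ]; field_simp
  have hcl : closure (hartogsDomain g) = Φ '' Q := by
    apply Set.Subset.antisymm
    · refine closure_minimal ?_ hKc.isClosed
      rw [← hΩ]
      exact Set.image_mono (Set.prod_mono ball_subset_closedBall ball_subset_closedBall)
    · rw [← hΩ]
      have : closure (ball (0 : ℂ) 1 ×ˢ ball (0 : ℂ) 1) = Q := by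
        rw [closure_prod_eq, closure_ball _ one_ne_zero]
      rw [← this]
      exact ContinuousOn.image_closure (by rwa [this])
  intro U hU hKU
  rw [hcl] at hKU ⊢
  obtain ⟨δ, hδ, hδU⟩ := hKc.exists_thickening_subset_open hU hKU
  obtain ⟨M, hM⟩ := (isCompact_closedBall (0 : ℂ) 1).exists_bound_of_continuousOn hψc
  obtain ⟨m, hm0, hm⟩ : ∃ m : ℝ, 0 < m ∧ ∀ z ∈ closedBall (0 : ℂ) 1, m ≤ ψ z := by
    obtain ⟨x, hx, hmin⟩ := (isCompact_closedBall (0 : ℂ) 1).exists_isMinOn ⟨0, by simp⟩ hψc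
    exact ⟨ψ x, hψ0 x hx, fun z hz => hmin hz⟩
  have hM0 : 0 ≤ M := (norm_nonneg _).trans (hM 0 (by simp))
  -- Enlarging the fibres by the factor 1 + ε moves the second coordinate by at most ε M.
  obtain ⟨ε, hε0, hε⟩ : ∃ ε : ℝ, 0 < ε ∧ ε * M < δ := by
    refine ⟨δ / (M + 1), by positivity, ?_⟩
    rw [div_mul_eq_mul_div, div_lt_iff₀ (by positivity)]; nlinarith
  -- With tolerance ε m, passing from z to z/R costs less than ε ψ(z/R), which the factor 1 + ε
  -- absorbs.
  obtain ⟨η, hη0, hη⟩ := Metric.uniformContinuousOn_iff.1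
    ((isCompact_closedBall (0 : ℂ) 1).uniformContinuousOn_of_continuous hψc) (ε * m) (by positivity)
  obtain ⟨R, hR1, hRδ, hRη⟩ : ∃ R : ℝ, 1 < R ∧ R - 1 < δ ∧ R - 1 < η := by
    refine ⟨1 + min δ η / 2, ?_, ?_, ?_⟩
    · have := lt_min hδ hη0; linarith
    · have := min_le_left δ η; have := lt_min hδ hη0; linarith
    · have := min_le_right δ η; have := lt_min hδ hη0; linarith
  have hR0 : 0 < R := by linarith
  have hRc : (R : ℂ) ≠ 0 := by exact_mod_cast hR0.ne'
  set G : ℂ → ℂ := fun z => ((1 + ε : ℝ) : ℂ) * g (z / R) with hG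
  have hdiv : ∀ z ∈ ball (0 : ℂ) R, z / R ∈ ball (0 : ℂ) 1 := fun z hz => by
    simp only [mem_ball_zero_iff, norm_div, Complex.norm_real, Real.norm_of_nonneg hR0.le] at *
    rwa [div_lt_one hR0]
  have hnG : ∀ z ∈ ball (0 : ℂ) R, ‖G z‖ = (1 + ε) * ψ (z / R) := fun z hz => by
    simp only [hG, norm_mul, Complex.norm_real]
    rw [Real.norm_of_nonneg (by linarith), hψ _ (hdiv z hz)]
  refine ⟨{z : ℂ × ℂ | z.1 ∈ ball (0 : ℂ) R ∧ ‖z.2‖ < ‖G z.1‖},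
    isPseudoconvexDomain_hartogs hR0 ?_ ?_, ⟨?_, ?_⟩, ?_⟩
  · exact (differentiableOn_const _).mul (hg.comp (by fun_prop) hdiv)
  · intro z hz
    refine mul_ne_zero ?_ (hg0 _ (hdiv z hz))
    exact_mod_cast (by linarith : (1 + ε : ℝ) ≠ 0)
  · rw [hKc.isClosed.closure_eq]; exact hKc
  · rw [hKc.isClosed.closure_eq]
    rintro _ ⟨p, ⟨hp1, hp2⟩, rfl⟩
    have hp1' : ‖p.1‖ ≤ 1 := by simpa using hp1
    have hp2' : ‖p.2‖ ≤ 1 := by simpa using hp2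
    have hb : p.1 ∈ ball (0 : ℂ) R := by rw [mem_ball_zero_iff]; linarith
    refine ⟨hb, ?_⟩
    show ‖(ψ p.1 : ℂ) * p.2‖ < ‖G p.1‖
    rw [hnG _ hb, norm_mul, Complex.norm_real, Real.norm_of_nonneg (hψ0 _ hp1).le]
    have hq := ball_subset_closedBall (hdiv _ hb)
    have hdist : dist p.1 (p.1 / R) < η := by
      have : p.1 - p.1 / R = p.1 / R * ((R - 1 : ℝ) : ℂ) := by
        push_cast; field_simp
      rw [dist_eq_norm, this, norm_mul, Complex.norm_real, Real.norm_of_nonneg (by linarith)]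
      have : ‖p.1 / R‖ ≤ 1 := by simpa using hq
      nlinarith [norm_nonneg (p.1 / R)]
    have h1 := (abs_lt.1 (hη _ hp1 _ hq hdist)).2
    have h2 := hm _ hq
    have h3 := hψ0 _ hp1
    nlinarith
  · have key : {z : ℂ × ℂ | z.1 ∈ ball (0 : ℂ) R ∧ ‖z.2‖ < ‖G z.1‖} ⊆
        (fun p : ℂ × ℂ => ((R : ℂ) * p.1, ((1 + ε : ℝ) : ℂ) * (ψ p.1 * p.2))) '' Q := by
      rintro z ⟨hz1, hz2⟩
      rw [hnG _ hz1] at hz2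
      have hq := hdiv _ hz1
      have h3 := hψ0 _ (ball_subset_closedBall hq)
      have h4 : 0 < (1 + ε) * ψ (z.1 / R) := by positivity
      have h4' : (((1 + ε) * ψ (z.1 / R) : ℝ) : ℂ) ≠ 0 := by exact_mod_cast h4.ne'
      refine ⟨(z.1 / R, z.2 / ((1 + ε) * ψ (z.1 / R) : ℝ)), ⟨ball_subset_closedBall hq, ?_⟩, ?_⟩
      · simp only [mem_closedBall_zero_iff, norm_div, Complex.norm_real,
          Real.norm_of_nonneg h4.le]
        rw [div_le_one h4]; exact hz2.le
      · ext
        · simp only; field_simp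
        · simp only
          rw [← mul_assoc, ← Complex.ofReal_mul, mul_div_cancel₀ _ h4']
    have hc : IsCompact ((fun p : ℂ × ℂ => ((R : ℂ) * p.1, ((1 + ε : ℝ) : ℂ) * (ψ p.1 * p.2))) '' Q) := by
      refine hQc.image_of_continuousOn (ContinuousOn.prodMk (by fun_prop) ?_)
      exact continuousOn_const.mul (continuous_snd.comp_continuousOn hΦc)
    have key2 := closure_minimal key hc.isClosed
    refine ⟨hc.of_isClosed_subset isClosed_closure key2, key2.trans ?_⟩
    rintro _ ⟨p, ⟨hp1, hp2⟩, rfl⟩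
    refine hδU (mem_thickening_iff.2 ⟨Φ p, ⟨p, ⟨hp1, hp2⟩, rfl⟩, ?_⟩)
    have hp1' : ‖p.1‖ ≤ 1 := by simpa using hp1
    have hp2' : ‖p.2‖ ≤ 1 := by simpa using hp2
    rw [Prod.dist_eq]
    refine max_lt ?_ ?_
    · have : (R : ℂ) * p.1 - p.1 = ((R - 1 : ℝ) : ℂ) * p.1 := by push_cast; ring
      rw [dist_eq_norm]
      simp only [hΦ]
      rw [this, norm_mul, Complex.norm_real, Real.norm_of_nonneg (by linarith)]
      nlinarith [norm_nonneg p.1]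
    · have : ((1 + ε : ℝ) : ℂ) * (ψ p.1 * p.2) - ψ p.1 * p.2 = (ε : ℂ) * (ψ p.1 * p.2) := by
        push_cast; ring
      rw [dist_eq_norm]
      simp only [hΦ]
      rw [this, norm_mul, norm_mul, Complex.norm_real, Complex.norm_real,
        Real.norm_of_nonneg hε0.le]
      have h5 := hM _ hp1
      have : ‖ψ p.1‖ * ‖p.2‖ ≤ M * 1 := mul_le_mul h5 hp2' (norm_nonneg _) hM0
      nlinarith

/-! ### Polar coordinates and the mean value property -/

/-- Integrability in polar coordinates. -/
theorem integrableOn_smul_comp_polarCoord_symm {E : Type*} [NormedAddCommGroup E] [NormedSpace ℝ E]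
    {F : ℂ → E} (hm : StronglyMeasurable F) (hF : Integrable F) :
    IntegrableOn (fun p : ℝ × ℝ => p.1 • F (Complex.polarCoord.symm p))
      (Set.Ioi (0 : ℝ) ×ˢ Set.Ioo (-Real.pi) Real.pi) := by
  have hc : Continuous fun p : ℝ × ℝ => Complex.polarCoord.symm p := by
    simp only [Complex.polarCoord_symm_apply]; fun_prop
  refine ⟨(continuous_fst.stronglyMeasurable.smul
    (hm.comp_measurable hc.measurable)).aestronglyMeasurable, ?_⟩
  have h := Complex.lintegral_comp_polarCoord_symm (fun z => ‖F z‖ₑ)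
  rw [polarCoord_target] at h
  rw [hasFiniteIntegral_iff_enorm]
  refine lt_of_eq_of_lt ?_ (hasFiniteIntegral_iff_enorm.1 hF.2)
  rw [← h]
  refine setLIntegral_congr_fun (measurableSet_Ioi.prod measurableSet_Ioo) fun p hp => ?_
  have hp1 : 0 < p.1 := hp.1
  simp only [enorm_smul, smul_eq_mul]
  rw [Real.enorm_of_nonneg hp1.le]

/-- Polar coordinates use angles in (-π, π), circle integrals use (0, 2π); periodicity reconciles
them. -/
theorem integral_Ioo_polarCoord_symm {E : Type*} [NormedAddCommGroup E] [NormedSpace ℝ E]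
    (F : ℂ → E) (r : ℝ) :
    ∫ θ in Set.Ioo (-Real.pi) Real.pi, r • F (Complex.polarCoord.symm (r, θ)) =
      r • ∫ θ in (0)..(2 * Real.pi), F (circleMap 0 r θ) := by
  rw [integral_smul]
  congr 1
  have hper : Function.Periodic (fun θ => F (circleMap 0 r θ)) (2 * Real.pi) := fun θ => by
    simp only [periodic_circleMap 0 r θ]
  have h1 := hper.intervalIntegral_add_eq 0 (-Real.pi)
  rw [zero_add] at h1
  rw [h1, intervalIntegral.integral_of_le (by linarith [Real.pi_pos]),
    ← integral_Ioc_eq_integral_Ioo]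
  have h2 : -Real.pi + 2 * Real.pi = Real.pi := by ring
  rw [h2]
  refine setIntegral_congr_fun measurableSet_Ioc fun θ _ => ?_
  simp [circleMap, Complex.exp_mul_I]

/-- Integration in polar coordinates. -/
theorem integral_eq_integral_polar {E : Type*} [NormedAddCommGroup E] [NormedSpace ℝ E]
    {F : ℂ → E} (hm : StronglyMeasurable F) (hF : Integrable F) :
    ∫ z, F z = ∫ r in Set.Ioi (0 : ℝ), r • ∫ θ in (0)..(2 * Real.pi), F (circleMap 0 r θ) := by
  rw [← Complex.integral_comp_polarCoord_symm, polarCoord_target, Measure.volume_eq_prod,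
    setIntegral_prod _ (integrableOn_smul_comp_polarCoord_symm hm hF)]
  simp only [integral_Ioo_polarCoord_symm]

theorem stronglyMeasurable_indicator_of_continuousOn {F : ℂ → ℂ} {s : Set ℂ} (hs : MeasurableSet s)
    (hF : ContinuousOn F s) : StronglyMeasurable (s.indicator F) := by
  classical
  have h := hF.measurable_piecewise (g := (0 : ℂ → ℂ)) continuousOn_const hs
  rw [Set.piecewise_eq_indicator] at h
  exact h.stronglyMeasurable

theorem circleMap_mem_ball_iff {r : ℝ} (hr : 0 < r) (θ : ℝ) :
    circleMap 0 r θ ∈ ball (0 : ℂ) 1 ↔ r < 1 := by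
  rw [mem_ball_zero_iff, norm_circleMap_zero, abs_of_pos hr]

/-- On each circle ρ is constant and H averages to H(0), so H enters the integral only through that
value. -/
theorem integral_radial_mul {ρ : ℝ → ℂ} (hρ : Continuous ρ) {H : ℂ → ℂ}
    (hH : DifferentiableOn ℂ H (ball 0 1))
    (hi : IntegrableOn (fun z => ρ ‖z‖ * H z) (ball 0 1)) :
    ∫ z in ball (0 : ℂ) 1, ρ ‖z‖ * H z =
      H 0 * ∫ r in Set.Ioi (0 : ℝ), if r < 1 then r • (ρ r * (2 * Real.pi)) else 0 := by
  have hc : ContinuousOn (fun z => ρ ‖z‖ * H z) (ball 0 1) :=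
    (hρ.comp continuous_norm).continuousOn.mul hH.continuousOn
  rw [← integral_indicator measurableSet_ball, integral_eq_integral_polar
    (stronglyMeasurable_indicator_of_continuousOn measurableSet_ball hc)
    (hi.integrable_indicator measurableSet_ball), ← integral_const_mul]
  refine setIntegral_congr_fun measurableSet_Ioi fun r hr => ?_
  have hr0 : 0 < r := hr
  split_ifs with h1
  · have hmv : Real.circleAverage H 0 r = H 0 := by
      refine DiffContOnCl.circleAverage (DifferentiableOn.diffContOnCl ?_)
      rw [abs_of_pos hr0, closure_ball _ hr0.ne']
      exact hH.mono (closedBall_subset_ball h1)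
    rw [Real.circleAverage_def, inv_smul_eq_iff₀ (by positivity)] at hmv
    have : ∀ θ, (ball (0 : ℂ) 1).indicator (fun z => ρ ‖z‖ * H z) (circleMap 0 r θ) =
        ρ r * H (circleMap 0 r θ) := fun θ => by
      rw [Set.indicator_of_mem ((circleMap_mem_ball_iff hr0 θ).2 h1), norm_circleMap_zero,
        abs_of_pos hr0]
    simp_rw [this]
    rw [intervalIntegral.integral_const_mul, hmv]
    simp only [Complex.real_smul]
    push_cast
    ring
  · have : ∀ θ, (ball (0 : ℂ) 1).indicator (fun z => ρ ‖z‖ * H z) (circleMap 0 r θ) = 0 := fun θ =>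
      Set.indicator_of_notMem (fun h => h1 ((circleMap_mem_ball_iff hr0 θ).1 h)) _
    simp [this]

/-- A radial weight of mean zero annihilates the holomorphic functions. -/
theorem integral_radial_mul_eq_zero {ρ : ℝ → ℂ} (hρ : Continuous ρ) {H : ℂ → ℂ}
    (hH : DifferentiableOn ℂ H (ball 0 1)) (h0 : ∫ z in ball (0 : ℂ) 1, ρ ‖z‖ = 0) :
    ∫ z in ball (0 : ℂ) 1, ρ ‖z‖ * H z = 0 := by
  -- In the nonintegrable case the Bochner integral is 0 by convention.
  by_cases hi : IntegrableOn (fun z => ρ ‖z‖ * H z) (ball 0 1)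
  · have h1 := integral_radial_mul hρ (differentiableOn_const (c := (1 : ℂ))) (by
      simp only [mul_one]
      exact ((hρ.comp continuous_norm).continuousOn.integrableOn_compact
        (isCompact_closedBall 0 1)).mono_set ball_subset_closedBall)
    simp only [mul_one, one_mul] at h1
    rw [integral_radial_mul hρ hH hi, ← h1, h0, mul_zero]
  · exact integral_undef hi

/-! ### Taylor coefficients and continuous extension to the closed disc -/

/-- The Taylor coefficients of an integrable holomorphic function grow at most linearly. -/
theorem exists_norm_iteratedDeriv_le_of_integrableOn {q : ℂ → ℂ}
    (hq : DifferentiableOn ℂ q (ball 0 1)) (hi : IntegrableOn q (ball 0 1)) :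
    ∃ C : ℝ, ∀ n : ℕ, ‖iteratedDeriv n q 0‖ ≤ C * (n + 2) * n.factorial := by
  set F : ℂ → ℝ := fun z => ‖(ball (0 : ℂ) 1).indicator q z‖ with hF
  have hsm := stronglyMeasurable_indicator_of_continuousOn measurableSet_ball hq.continuousOn
  have hFm : StronglyMeasurable F := hsm.norm
  have hFi : Integrable F := (hi.integrable_indicator measurableSet_ball).norm
  have hpol := integral_eq_integral_polar hFm hFi
  refine ⟨(2 * Real.pi)⁻¹ * ∫ z, F z, fun n => ?_⟩
  set b := ‖iteratedDeriv n q 0‖ / n.factorial with hb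
  have hn : (0 : ℝ) < n.factorial := by exact_mod_cast n.factorial_pos
  -- Cauchy's estimate on the circle of radius r. Integrated against r dr over (0, 1), the factor rⁿ
  -- becomes 1/(n + 2), which produces the linear growth.
  have hcoef : ∀ r : ℝ, 0 < r → r < 1 →
      2 * Real.pi * b * r ^ n ≤ ∫ θ in (0)..(2 * Real.pi), F (circleMap 0 r θ) := by
    intro r hr0 hr1
    have hps := DifferentiableOn.hasFPowerSeriesOnBall (R := ⟨r, hr0.le⟩) (c := 0)
      (hq.mono (closedBall_subset_ball hr1)) hr0
    change HasFPowerSeriesOnBall q (cauchyPowerSeries q 0 r) 0 _ at hps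
    have h1 := hps.factorial_smul 1 n
    have h2 := norm_cauchyPowerSeries_le q 0 r n
    have h3 : iteratedDeriv n q 0 = (n.factorial : ℂ) * cauchyPowerSeries q 0 r n (fun _ => 1) := by
      rw [iteratedDeriv_eq_iteratedFDeriv]
      simpa using h1.symm
    have h4 : b ≤ ‖cauchyPowerSeries q 0 r n‖ := by
      rw [hb, h3, norm_mul, Complex.norm_natCast, mul_div_cancel_left₀ _ hn.ne']
      simp
    have h5 : ∫ θ in (0)..(2 * Real.pi), F (circleMap 0 r θ) =
        ∫ θ in (0)..(2 * Real.pi), ‖q (circleMap 0 r θ)‖ := by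
      refine intervalIntegral.integral_congr fun θ _ => ?_
      simp only [hF]
      rw [Set.indicator_of_mem ((circleMap_mem_ball_iff hr0 θ).2 hr1)]
    rw [h5]
    have h6 := h4.trans h2
    rw [abs_of_pos hr0, inv_pow, mul_assoc, inv_mul_eq_div, ← div_eq_mul_inv, le_div_iff₀
      (by positivity), le_div_iff₀ (by positivity)] at h6
    linarith
  have hI : IntegrableOn (fun r : ℝ => r • ∫ θ in (0)..(2 * Real.pi), F (circleMap 0 r θ))
      (Set.Ioi 0) := by
    have h := integrableOn_smul_comp_polarCoord_symm hFm hFi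
    rw [IntegrableOn, Measure.volume_eq_prod, ← Measure.prod_restrict] at h
    exact h.integral_prod_left.congr
      (Filter.Eventually.of_forall (integral_Ioo_polarCoord_symm F))
  have hnn : ∀ r ∈ Set.Ioi (0 : ℝ), 0 ≤ r • ∫ θ in (0)..(2 * Real.pi), F (circleMap 0 r θ) :=
    fun r hr => smul_nonneg (le_of_lt hr) (intervalIntegral.integral_nonneg (by positivity)
      fun _ _ => norm_nonneg _)
  have hlow : ∫ r in Set.Ioo (0 : ℝ) 1, 2 * Real.pi * b * r ^ (n + 1) ≤ ∫ z, F z := by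
    rw [hpol]
    refine le_trans ?_ (setIntegral_mono_set hI ((ae_restrict_iff' measurableSet_Ioi).2
      (Filter.Eventually.of_forall hnn)) (Set.Ioo_subset_Ioi_self : Set.Ioo (0 : ℝ) 1 ⊆ _).eventuallyLE)
    refine setIntegral_mono_on ?_ (hI.mono_set Set.Ioo_subset_Ioi_self) measurableSet_Ioo ?_
    · exact (Continuous.integrableOn_Icc (by fun_prop)).mono_set Set.Ioo_subset_Icc_self
    · intro r hr
      have := hcoef r hr.1 hr.2
      have hr0 := hr.1
      rw [smul_eq_mul, pow_succ]
      nlinarith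
  rw [← integral_Ioc_eq_integral_Ioo, ← intervalIntegral.integral_of_le zero_le_one,
    intervalIntegral.integral_const_mul, integral_pow] at hlow
  have hpos : (0 : ℝ) < n + 2 := by positivity
  have h7 : b ≤ (2 * Real.pi)⁻¹ * (∫ z, F z) * (n + 2) := by
    rw [inv_mul_eq_div, div_mul_eq_mul_div, le_div_iff₀ (by positivity)]
    have e : 2 * Real.pi * b * ((1 ^ (n + 1 + 1) - 0 ^ (n + 1 + 1)) / (((n + 1 : ℕ) : ℝ) + 1)) =
        2 * Real.pi * b / (n + 2) := by
      push_cast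
      rw [one_pow, zero_pow (by omega)]
      field_simp
      ring
    rw [e, div_le_iff₀ hpos] at hlow
    linarith
  rw [hb, div_le_iff₀ hn] at h7
  exact h7

/-- A holomorphic function on the disc with integrable third derivative extends continuously to
the closed disc. -/
theorem exists_continuousOn_extension_of_integrableOn {u : ℂ → ℂ}
    (hu : DifferentiableOn ℂ u (ball 0 1)) (hi : IntegrableOn (iteratedDeriv 3 u) (ball 0 1)) :
    ∃ V : ℂ → ℂ, ContinuousOn V (closedBall 0 1) ∧ ∀ z ∈ ball (0 : ℂ) 1, V z = u z := by
  have hdq : DifferentiableOn ℂ (iteratedDeriv 3 u) (ball 0 1) := by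
    have h1 := hu.deriv isOpen_ball
    have h2 := h1.deriv isOpen_ball
    have h3 := h2.deriv isOpen_ball
    simpa [iteratedDeriv_succ] using h3
  obtain ⟨C, hC⟩ := exists_norm_iteratedDeriv_le_of_integrableOn hdq hi
  have hC' : ∀ n : ℕ, ‖iteratedDeriv (n + 3) u 0‖ ≤ C * (n + 2) * n.factorial := fun n => by
    have := hC n
    rwa [iteratedDeriv_eq_iterate, iteratedDeriv_eq_iterate, ← Function.iterate_add_apply,
      ← iteratedDeriv_eq_iterate] at this
  have hC0 : 0 ≤ C := by
    have := (norm_nonneg _).trans (hC 0)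
    norm_num at this
    linarith
  set a : ℕ → ℂ := fun n => (n.factorial : ℂ)⁻¹ * iteratedDeriv n u 0 with ha
  have hsum : Summable fun n => ‖a n‖ := by
    -- The bound on the third derivative gives |a(n+3)| ≤ C (n+2) n!/(n+3)! = C/((n+3)(n+1)) ≤
    -- C/(n+1)².
    rw [← summable_nat_add_iff 3]
    have hs : Summable fun n : ℕ => C * (1 / ((n + 1 : ℕ) : ℝ) ^ 2) :=
      ((summable_nat_add_iff 1).2 (Real.summable_one_div_nat_pow.2 one_lt_two)).mul_left C
    refine Summable.of_nonneg_of_le (fun n => norm_nonneg _) (fun n => ?_) hs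
    have hn : (0 : ℝ) < n.factorial := by exact_mod_cast n.factorial_pos
    have hf : ((n + 3).factorial : ℝ) = (n + 3) * (n + 2) * (n + 1) * n.factorial := by
      rw [Nat.factorial_succ, Nat.factorial_succ, Nat.factorial_succ]; push_cast; ring
    simp only [ha, norm_mul, norm_inv, Complex.norm_natCast]
    rw [inv_mul_le_iff₀ (by positivity), hf]
    refine (hC' n).trans ?_
    push_cast
    have e : (n + 3) * (n + 2) * (n + 1) * (n.factorial : ℝ) * (C * (1 / ((n : ℝ) + 1) ^ 2)) =
        C * (n + 2) * n.factorial * ((n + 3) / (n + 1)) := by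
      field_simp
    rw [e]
    refine le_mul_of_one_le_right (by positivity) ?_
    rw [one_le_div (by positivity)]
    linarith
  refine ⟨fun z => ∑' n, a n * z ^ n, ?_, fun z hz => ?_⟩
  · refine continuousOn_tsum (fun n => by fun_prop) hsum fun n z hz => ?_
    rw [norm_mul, norm_pow]
    have : ‖z‖ ≤ 1 := by simpa using hz
    exact mul_le_of_le_one_right (norm_nonneg _) (pow_le_one₀ (norm_nonneg _) this)
  · have := Complex.taylorSeries_eq_on_ball' hz hu
    simpa [ha] using this

/-! ### Classical and weak derivatives -/

theorem contDiffAt_partialDeriv {j : ℕ} (w : Fin j → Fin 4) {f : ℂ × ℂ → ℂ} {z : ℂ × ℂ}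
    (hf : ContDiffAt ℝ ∞ f z) : ContDiffAt ℝ ∞ (partialDeriv w f) z := by
  have h := hf.iteratedFDeriv_right (m := ∞) (i := j) (mod_cast le_top)
  exact (ContinuousMultilinearMap.apply ℝ (fun _ : Fin j => ℂ × ℂ) ℂ
    (fun i => coordDir (w i))).contDiff.contDiffAt.comp z h

theorem partialDeriv_succ_left {j : ℕ} (w : Fin (j + 1) → Fin 4) {f : ℂ × ℂ → ℂ} {z : ℂ × ℂ}
    (hf : ContDiffAt ℝ ∞ f z) :
    partialDeriv w f z = fderiv ℝ (partialDeriv (Fin.tail w) f) z (coordDir (w 0)) := by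
  have h : ContDiffAt ℝ ∞ (iteratedFDeriv ℝ j f) z :=
    hf.iteratedFDeriv_right (m := ∞) (i := j) (mod_cast le_top)
  exact (h.differentiableAt (by simp)).iteratedFDeriv_succ_apply_left'

theorem partialDeriv_succ_right {j : ℕ} (w : Fin (j + 1) → Fin 4) {f : ℂ × ℂ → ℂ}
    (hf : ContDiff ℝ ∞ f) (z : ℂ × ℂ) :
    partialDeriv w f z =
      partialDeriv (Fin.init w) (fun y => fderiv ℝ f y (coordDir (w (Fin.last j)))) z := by
  have h : ContDiff ℝ ∞ (fderiv ℝ f) := hf.fderiv_right (by simp)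
  have h2 := (ContinuousLinearMap.apply ℝ ℂ (coordDir (w (Fin.last j)))).iteratedFDeriv_comp_left
    h.contDiffAt (x := z) (i := j) (mod_cast le_top)
  have h3 : (fun y => fderiv ℝ f y (coordDir (w (Fin.last j)))) =
    (ContinuousLinearMap.apply ℝ ℂ (coordDir (w (Fin.last j)))) ∘ fderiv ℝ f := rfl
  rw [partialDeriv, partialDeriv, iteratedFDeriv_succ_apply_right, h3, h2]
  rfl

theorem integrable_continuousOn_mul {Ω : Set (ℂ × ℂ)} {f φ : ℂ × ℂ → ℂ}
    (hf : ContinuousOn f Ω) (hφ : Continuous φ) (hc : HasCompactSupport φ) (hs : tsupport φ ⊆ Ω) :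
    Integrable (fun z => f z * φ z) := by
  have h : IntegrableOn (fun z => f z * φ z) (tsupport φ) :=
    ((hf.mono hs).mul hφ.continuousOn).integrableOn_compact hc
  refine h.integrable_of_forall_notMem_eq_zero fun z hz => ?_
  rw [image_eq_zero_of_notMem_tsupport hz, mul_zero]

theorem setIntegral_mul_eq_integral {Ω : Set (ℂ × ℂ)} {f φ : ℂ × ℂ → ℂ} (hs : tsupport φ ⊆ Ω) :
    ∫ z in Ω, f z * φ z = ∫ z, f z * φ z := by
  refine setIntegral_eq_integral_of_forall_compl_eq_zero fun z hz => ?_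
  rw [image_eq_zero_of_notMem_tsupport fun h => hz (hs h), mul_zero]

instance isAddHaarMeasure_volume_complex_prod : (volume : Measure (ℂ × ℂ)).IsAddHaarMeasure := by
  rw [Measure.volume_eq_prod]
  infer_instance

/-- Integration by parts against a test function. -/
theorem setIntegral_mul_fderiv_eq_neg {Ω : Set (ℂ × ℂ)} (hΩ : IsOpen Ω) {f φ : ℂ × ℂ → ℂ}
    (hf : ContDiffOn ℝ ∞ f Ω) (hφ : ContDiff ℝ ∞ φ) (hc : HasCompactSupport φ)
    (hs : tsupport φ ⊆ Ω) (v : ℂ × ℂ) :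
    ∫ z in Ω, f z * fderiv ℝ φ z v = -∫ z in Ω, fderiv ℝ f z v * φ z := by
  have hsub := tsupport_fderiv_apply_subset ℝ (f := φ) v
  rw [setIntegral_mul_eq_integral (hsub.trans hs), setIntegral_mul_eq_integral hs]
  have hdiff : ∀ z ∈ Ω, ContDiffAt ℝ ∞ f z := fun z hz => hf.contDiffAt (hΩ.mem_nhds hz)
  refine integral_mul_fderiv_eq_neg_fderiv_mul_of_integrable ?_ ?_ ?_ ?_ ?_
  · refine integrable_continuousOn_mul ?_ hφ.continuous hc hs
    exact (hf.continuousOn_fderiv_of_isOpen hΩ (by simp)).clm_apply continuousOn_const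
  · refine integrable_continuousOn_mul hf.continuousOn ?_ ?_ (hsub.trans hs)
    · exact (hφ.continuous_fderiv (by simp)).clm_apply continuous_const
    · exact hc.of_isClosed_subset (isClosed_tsupport _) hsub
  · exact integrable_continuousOn_mul hf.continuousOn hφ.continuous hc hs
  · exact fun z hz => (hdiff z (hs hz)).differentiableAt (by simp)
  · exact fun z _ => hφ.contDiffAt.differentiableAt (by simp)

theorem contDiffOn_partialDeriv {Ω : Set (ℂ × ℂ)} (hΩ : IsOpen Ω) {j : ℕ} (w : Fin j → Fin 4)
    {f : ℂ × ℂ → ℂ} (hf : ContDiffOn ℝ ∞ f Ω) : ContDiffOn ℝ ∞ (partialDeriv w f) Ω :=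
  fun _ hz => (contDiffAt_partialDeriv w (hf.contDiffAt (hΩ.mem_nhds hz))).contDiffWithinAt

/-- Each integration by parts takes the innermost derivative of φ and makes it the outermost one on
f. The directions thus come out reversed, and symmetry of higher derivatives is never invoked. -/
theorem setIntegral_mul_partialDeriv {Ω : Set (ℂ × ℂ)} (hΩ : IsOpen Ω) {f : ℂ × ℂ → ℂ}
    (hf : ContDiffOn ℝ ∞ f Ω) {j : ℕ} (w : Fin j → Fin 4) (φ : ℂ × ℂ → ℂ) (hφ : ContDiff ℝ ∞ φ)
    (hc : HasCompactSupport φ) (hs : tsupport φ ⊆ Ω) :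
    ∫ z in Ω, f z * partialDeriv w φ z =
      (-1 : ℂ) ^ j * ∫ z in Ω, partialDeriv (w ∘ Fin.rev) f z * φ z := by
  induction j generalizing φ with
  | zero => simp [partialDeriv]
  | succ j ih =>
    set v := coordDir (w (Fin.last j)) with hv
    have hsub := tsupport_fderiv_apply_subset ℝ (f := φ) v
    have h1 : ∀ z, partialDeriv w φ z = partialDeriv (Fin.init w) (fun y => fderiv ℝ φ y v) z :=
      partialDeriv_succ_right w hφ
    have h2 : ∀ z ∈ Ω, partialDeriv (w ∘ Fin.rev) f z =
        fderiv ℝ (partialDeriv (Fin.init w ∘ Fin.rev) f) z v := fun z hz => by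
      rw [partialDeriv_succ_left _ (hf.contDiffAt (hΩ.mem_nhds hz))]
      have e1 : Fin.tail (w ∘ Fin.rev) = Fin.init w ∘ Fin.rev := by
        ext i; simp [Fin.tail, Fin.init, Fin.rev_succ]
      rw [e1]; simp [hv]
    have hφ' : ContDiff ℝ ∞ (fun y => fderiv ℝ φ y v) :=
      (hφ.fderiv_right (m := ∞) (by simp)).clm_apply contDiff_const
    simp_rw [h1]
    rw [ih (Fin.init w) _ hφ' (hc.of_isClosed_subset (isClosed_tsupport _) hsub) (hsub.trans hs),
      setIntegral_mul_fderiv_eq_neg hΩ (contDiffOn_partialDeriv hΩ _ hf) hφ hc hs,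
      setIntegral_congr_fun hΩ.measurableSet fun z hz => by rw [← h2 z hz]]
    ring

theorem hasWeakDeriv_partialDeriv {Ω : Set (ℂ × ℂ)} (hΩ : IsOpen Ω) {f : ℂ × ℂ → ℂ}
    (hf : ContDiffOn ℝ ∞ f Ω) {j : ℕ} (w : Fin j → Fin 4) :
    HasWeakDeriv Ω w f (partialDeriv (w ∘ Fin.rev) f) :=
  ⟨hf.continuousOn.locallyIntegrableOn hΩ.measurableSet,
    (contDiffOn_partialDeriv hΩ _ hf).continuousOn.locallyIntegrableOn hΩ.measurableSet,
    setIntegral_mul_partialDeriv hΩ hf w⟩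

theorem LocallyIntegrableOn.integrable_mul_test {Ω : Set (ℂ × ℂ)} {v φ : ℂ × ℂ → ℂ}
    (hv : LocallyIntegrableOn v Ω) (hφ : Continuous φ) (hc : HasCompactSupport φ)
    (hs : tsupport φ ⊆ Ω) : IntegrableOn (fun z => v z * φ z) Ω := by
  refine Integrable.integrableOn ?_
  have h : IntegrableOn (fun z => v z * φ z) (tsupport φ) :=
    (hv.integrableOn_compact_subset hs hc).mul_continuousOn hφ.continuousOn hc
  refine h.integrable_of_forall_notMem_eq_zero fun z hz => ?_
  rw [image_eq_zero_of_notMem_tsupport hz, mul_zero]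

/-- Weak derivatives are unique up to null sets. -/
theorem HasWeakDeriv.ae_unique {Ω : Set (ℂ × ℂ)} (hΩ : IsOpen Ω) {j : ℕ} {w : Fin j → Fin 4}
    {f v₁ v₂ : ℂ × ℂ → ℂ} (h₁ : HasWeakDeriv Ω w f v₁) (h₂ : HasWeakDeriv Ω w f v₂) :
    v₁ =ᵐ[volume.restrict Ω] v₂ := by
  have h := hΩ.ae_eq_zero_of_integral_contDiff_smul_eq_zero (μ := volume)
    (f := fun z => v₁ z - v₂ z) (h₁.2.1.sub h₂.2.1) ?_
  · rw [Filter.EventuallyEq, ae_restrict_iff' hΩ.measurableSet]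
    filter_upwards [h] with z hz hzΩ using sub_eq_zero.1 (hz hzΩ)
  · intro ψ hψ hc hs
    set φ : ℂ × ℂ → ℂ := fun z => (ψ z : ℂ) with hφ
    have hsupp : Function.support φ = Function.support ψ := by ext; simp [hφ]
    have ht : tsupport φ = tsupport ψ := by rw [tsupport, tsupport, hsupp]
    have hφc : ContDiff ℝ ∞ φ := Complex.ofRealCLM.contDiff.comp hψ
    have hcφ : HasCompactSupport φ := by rw [HasCompactSupport, ht]; exact hc
    have hsφ : tsupport φ ⊆ Ω := by rw [ht]; exact hs
    have e1 := h₁.2.2 φ hφc hcφ hsφ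
    rw [h₂.2.2 φ hφc hcφ hsφ] at e1
    have e2 := mul_left_cancel₀ (pow_ne_zero _ (neg_ne_zero.2 one_ne_zero)) e1
    have e3 : ∫ z, ψ z • (v₁ z - v₂ z) = ∫ z in Ω, (v₁ z * φ z - v₂ z * φ z) := by
      rw [← setIntegral_eq_integral_of_forall_compl_eq_zero (s := Ω)]
      · refine integral_congr_ae (Filter.Eventually.of_forall fun z => ?_)
        simp only [hφ, Complex.real_smul]; ring
      · intro z hz
        rw [image_eq_zero_of_notMem_tsupport fun h => hz (hs h), zero_smul]
    rw [e3, integral_sub (LocallyIntegrableOn.integrable_mul_test h₁.2.1 hφc.continuous hcφ hsφ)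
      (LocallyIntegrableOn.integrable_mul_test h₂.2.1 hφc.continuous hcφ hsφ), e2, sub_self]

/-- Bounded functions are square integrable on a set of finite volume. This reduces both halves of
the main theorem to a single statement about W⁴. -/
theorem MemSmoothBounded.memSobolev {Ω : Set (ℂ × ℂ)} (hΩ : IsOpen Ω) (hvol : volume Ω ≠ ⊤)
    {f : ℂ × ℂ → ℂ} (hf : MemSmoothBounded Ω f) (k : ℕ) : MemSobolev Ω k f := by
  have : IsFiniteMeasure (volume.restrict Ω) := isFiniteMeasure_restrict.2 hvol
  have key : ∀ (j : ℕ) (w : Fin j → Fin 4), MemLp (partialDeriv w f) 2 (volume.restrict Ω) := by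
    intro j w
    obtain ⟨M, hM⟩ := hf.2 j w
    refine MemLp.of_bound ((contDiffOn_partialDeriv hΩ w hf.1).continuousOn.aestronglyMeasurable
      hΩ.measurableSet) M ?_
    exact (ae_restrict_iff' hΩ.measurableSet).2 (Filter.Eventually.of_forall hM)
  refine ⟨?_, fun j _ w => ⟨_, hasWeakDeriv_partialDeriv hΩ hf.1 w, key _ _⟩⟩
  have h0 : partialDeriv ![] f = f := by ext z; simp [partialDeriv]
  exact h0 ▸ key 0 ![]

theorem MemSobolev.congr_ae {Ω : Set (ℂ × ℂ)} {k : ℕ} {f f' : ℂ × ℂ → ℂ}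
    (hf : MemSobolev Ω k f) (h : f =ᵐ[volume.restrict Ω] f') : MemSobolev Ω k f' := by
  refine ⟨hf.1.ae_eq h, fun j hj w => ?_⟩
  obtain ⟨v, hv, hv2⟩ := hf.2 j hj w
  refine ⟨v, ⟨?_, hv.2.1, fun φ hφ hc hs => ?_⟩, hv2⟩
  · exact locallyIntegrableOn_of_locallyIntegrable_restrict
      ((hf.1.ae_eq h).locallyIntegrable one_le_two)
  · rw [← hv.2.2 φ hφ hc hs]
    refine integral_congr_ae ?_
    filter_upwards [h] with z hz
    rw [hz]

/-! ### Change of variables from the bidisc -/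

theorem isOpen_hartogsDomain {g : ℂ → ℂ} (hg : DifferentiableOn ℂ g (ball 0 1))
    (hg0 : ∀ z ∈ ball (0 : ℂ) 1, g z ≠ 0) : IsOpen (hartogsDomain g) :=
  (isPseudoconvexDomain_hartogs one_pos hg hg0).1

theorem hartogsDomain_subset {g : ℂ → ℂ} {M : ℝ} (hM : ∀ z ∈ ball (0 : ℂ) 1, ‖g z‖ ≤ M) :
    hartogsDomain g ⊆ closedBall (0 : ℂ) 1 ×ˢ closedBall (0 : ℂ) M := fun z hz =>
  ⟨ball_subset_closedBall hz.1, by simpa using hz.2.le.trans (hM _ hz.1)⟩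

/-- The parametrization of the Hartogs domain by the bidisc. -/
noncomputable def hartogsParam (g : ℂ → ℂ) (p : ℂ × ℂ) : ℂ × ℂ := (p.1, g p.1 * p.2)

theorem hartogsParam_image {g : ℂ → ℂ} (hg0 : ∀ z ∈ ball (0 : ℂ) 1, g z ≠ 0) :
    hartogsParam g '' (ball 0 1 ×ˢ ball 0 1) = hartogsDomain g := by
  ext z
  constructor
  · rintro ⟨p, hp, rfl⟩
    refine ⟨hp.1, ?_⟩
    have h1 := norm_pos_iff.2 (hg0 _ hp.1)
    have h2 : ‖p.2‖ < 1 := by simpa using hp.2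
    simp only [hartogsParam, norm_mul]
    nlinarith
  · rintro ⟨hz1, hz2⟩
    refine ⟨(z.1, z.2 / g z.1), ⟨hz1, ?_⟩, ?_⟩
    · simp only [mem_ball_zero_iff, norm_div]
      rwa [div_lt_one (norm_pos_iff.2 (hg0 _ hz1))]
    · ext
      · simp [hartogsParam]
      · simp only [hartogsParam]; rw [mul_div_cancel₀ _ (hg0 _ hz1)]

theorem hartogsParam_injOn {g : ℂ → ℂ} (hg0 : ∀ z ∈ ball (0 : ℂ) 1, g z ≠ 0) :
    Set.InjOn (hartogsParam g) (ball 0 1 ×ˢ ball 0 1) := by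
  rintro ⟨a, t⟩ hp ⟨b, s⟩ _ h
  simp only [hartogsParam, Prod.mk.injEq] at h
  obtain ⟨rfl, h2⟩ := h
  rw [mul_left_cancel₀ (hg0 _ hp.1) h2]

/-- The complex derivative of `hartogsParam`. -/
noncomputable def hartogsParamDeriv (g : ℂ → ℂ) (p : ℂ × ℂ) : (ℂ × ℂ) →L[ℂ] ℂ × ℂ :=
  (ContinuousLinearMap.fst ℂ ℂ ℂ).prod (g p.1 • ContinuousLinearMap.snd ℂ ℂ ℂ +
    (p.2 * deriv g p.1) • ContinuousLinearMap.fst ℂ ℂ ℂ)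

theorem hasFDerivWithinAt_hartogsParam {g : ℂ → ℂ} (hg : DifferentiableOn ℂ g (ball 0 1))
    (p : ℂ × ℂ) (hp : p ∈ ball (0 : ℂ) 1 ×ˢ ball (0 : ℂ) 1) :
    HasFDerivWithinAt (hartogsParam g) ((hartogsParamDeriv g p).restrictScalars ℝ)
      (ball 0 1 ×ˢ ball 0 1) p := by
  have h1 : HasDerivAt g (deriv g p.1) p.1 :=
    (hg.differentiableAt (isOpen_ball.mem_nhds hp.1)).hasDerivAt
  have h2 : HasFDerivAt (fun p : ℂ × ℂ => g p.1) (deriv g p.1 • ContinuousLinearMap.fst ℂ ℂ ℂ) p :=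
    h1.comp_hasFDerivAt p hasFDerivAt_fst
  have h3 : HasFDerivAt (hartogsParam g) (hartogsParamDeriv g p) p := by
    refine (hasFDerivAt_fst (𝕜 := ℂ) (p := p)).prodMk ((h2.mul hasFDerivAt_snd).congr_fderiv ?_)
    rw [smul_smul]
  exact (h3.restrictScalars ℝ).hasFDerivWithinAt

/-- The complex Jacobian matrix is triangular with diagonal 1, g; the real determinant is the
squared modulus of the complex one. -/
theorem abs_det_hartogsParamDeriv (g : ℂ → ℂ) (p : ℂ × ℂ) :
    |((hartogsParamDeriv g p).restrictScalars ℝ).det| = ‖g p.1‖ ^ 2 := by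
  have h1 : LinearMap.det (hartogsParamDeriv g p : ℂ × ℂ →ₗ[ℂ] ℂ × ℂ) = g p.1 := by
    rw [← LinearMap.det_toMatrix (Module.Basis.finTwoProd ℂ), Matrix.det_fin_two]
    simp [LinearMap.toMatrix_apply, hartogsParamDeriv]
  have h2 : ((hartogsParamDeriv g p).restrictScalars ℝ).det = ‖g p.1‖ ^ 2 := by
    rw [ContinuousLinearMap.det]
    have := LinearMap.det_restrictScalars (R := ℝ)
      (f := (hartogsParamDeriv g p : ℂ × ℂ →ₗ[ℂ] ℂ × ℂ))
    rw [h1, Algebra.norm_complex_eq] at this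
    rw [← Complex.normSq_eq_norm_sq]
    exact this
  rw [h2, abs_of_nonneg (by positivity)]

theorem integrableOn_hartogsDomain_iff {E : Type*} [NormedAddCommGroup E] [NormedSpace ℝ E]
    {g : ℂ → ℂ} (hg : DifferentiableOn ℂ g (ball 0 1)) (hg0 : ∀ z ∈ ball (0 : ℂ) 1, g z ≠ 0)
    (F : ℂ × ℂ → E) : IntegrableOn F (hartogsDomain g) ↔
      IntegrableOn (fun p => ‖g p.1‖ ^ 2 • F (hartogsParam g p)) (ball 0 1 ×ˢ ball 0 1) := by
  rw [← hartogsParam_image hg0, integrableOn_image_iff_integrableOn_abs_det_fderiv_smul volume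
    (measurableSet_ball.prod measurableSet_ball) (hasFDerivWithinAt_hartogsParam hg)
    (hartogsParam_injOn hg0)]
  simp_rw [abs_det_hartogsParamDeriv]

theorem setIntegral_hartogsDomain {E : Type*} [NormedAddCommGroup E] [NormedSpace ℝ E]
    {g : ℂ → ℂ} (hg : DifferentiableOn ℂ g (ball 0 1)) (hg0 : ∀ z ∈ ball (0 : ℂ) 1, g z ≠ 0)
    (F : ℂ × ℂ → E) : ∫ z in hartogsDomain g, F z =
      ∫ p in ball 0 1 ×ˢ ball 0 1, ‖g p.1‖ ^ 2 • F (hartogsParam g p) := by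
  rw [← hartogsParam_image hg0, integral_image_eq_integral_abs_det_fderiv_smul volume
    (measurableSet_ball.prod measurableSet_ball) (hasFDerivWithinAt_hartogsParam hg)
    (hartogsParam_injOn hg0)]
  simp_rw [abs_det_hartogsParamDeriv]

/-! ### The function z₂ / g(z₁)² and its Bergman projection -/

/-- The holomorphic function `z₂ / g(z₁)²` on the Hartogs domain. -/
noncomputable def hartogsFun (g : ℂ → ℂ) (z : ℂ × ℂ) : ℂ := z.2 * (g z.1 ^ 2)⁻¹

theorem differentiableOn_inv_sq {g : ℂ → ℂ} (hg : DifferentiableOn ℂ g (ball 0 1))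
    (hg0 : ∀ z ∈ ball (0 : ℂ) 1, g z ≠ 0) :
    DifferentiableOn ℂ (fun z => (g z ^ 2)⁻¹) (ball 0 1) :=
  (hg.pow 2).inv fun z hz => pow_ne_zero 2 (hg0 z hz)

theorem differentiableOn_hartogsFun {g : ℂ → ℂ} (hg : DifferentiableOn ℂ g (ball 0 1))
    (hg0 : ∀ z ∈ ball (0 : ℂ) 1, g z ≠ 0) :
    DifferentiableOn ℂ (hartogsFun g) (hartogsDomain g) :=
  differentiableOn_snd.mul ((differentiableOn_inv_sq hg hg0).comp differentiableOn_fst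
    fun _ hz => hz.1)

/-- On the bidisc the function becomes t / g, and the Jacobian |g|² cancels the denominator, leaving
|t|². -/
theorem memLp_hartogsFun {g : ℂ → ℂ} (hg : DifferentiableOn ℂ g (ball 0 1))
    (hg0 : ∀ z ∈ ball (0 : ℂ) 1, g z ≠ 0) :
    MemLp (hartogsFun g) 2 (volume.restrict (hartogsDomain g)) := by
  rw [memLp_two_iff_integrable_sq_norm]
  · change IntegrableOn _ _ _
    rw [integrableOn_hartogsDomain_iff hg hg0]
    have h : IntegrableOn (fun p : ℂ × ℂ => ‖p.2‖ ^ 2) (ball 0 1 ×ˢ ball 0 1) :=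
      ((by fun_prop : Continuous fun p : ℂ × ℂ => ‖p.2‖ ^ 2).continuousOn.integrableOn_compact
        ((isCompact_closedBall 0 1).prod (isCompact_closedBall 0 1))).mono_set
        (Set.prod_mono ball_subset_closedBall ball_subset_closedBall)
    refine h.congr_fun (fun p hp => ?_) (measurableSet_ball.prod measurableSet_ball)
    have h1 := (norm_pos_iff.2 (hg0 _ hp.1)).ne'
    simp only [hartogsFun, hartogsParam, norm_mul, norm_inv, norm_pow, smul_eq_mul]
    field_simp
  · exact (differentiableOn_hartogsFun hg hg0).continuousOn.aestronglyMeasurable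
      (isOpen_hartogsDomain hg hg0).measurableSet

/-- A radial multiple of mean zero of `z₂ / g(z₁)²` is orthogonal to the holomorphic functions. -/
theorem integral_radial_hartogsFun_mul_eq_zero {g : ℂ → ℂ} (hg : DifferentiableOn ℂ g (ball 0 1))
    (hg0 : ∀ z ∈ ball (0 : ℂ) 1, g z ≠ 0) {ρ : ℝ → ℝ} (hρ : Continuous ρ)
    (h0 : ∫ z in ball (0 : ℂ) 1, (ρ ‖z‖ : ℂ) = 0) {G : ℂ × ℂ → ℂ}
    (hG : DifferentiableOn ℂ G (hartogsDomain g)) :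
    ∫ z in hartogsDomain g, (starRingEnd ℂ) (ρ ‖z.1‖ * hartogsFun g z) * G z = 0 := by
  by_cases hi : IntegrableOn (fun z : ℂ × ℂ =>
    (starRingEnd ℂ) (ρ ‖z.1‖ * hartogsFun g z) * G z) (hartogsDomain g)
  · rw [integrableOn_hartogsDomain_iff hg hg0] at hi
    rw [setIntegral_hartogsDomain hg hg0]
    rw [IntegrableOn, Measure.volume_eq_prod, ← Measure.prod_restrict] at hi
    rw [Measure.volume_eq_prod, ← Measure.prod_restrict, integral_prod_symm _ hi]
    refine setIntegral_eq_zero_of_forall_eq_zero fun t ht => ?_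
    -- For fixed t this is the whole integrand apart from the radial weight: the conjugate of t / g
    -- times |g|² equals conj(t) g, with no conjugate of g left.
    have hH : DifferentiableOn ℂ (fun z => (starRingEnd ℂ) t * (g z * G (z, g z * t)))
        (ball 0 1) := by
      refine (differentiableOn_const _).mul (hg.mul ?_)
      refine hG.comp (f := fun z => (z, g z * t))
        (differentiableOn_id.prodMk (hg.mul (differentiableOn_const _))) fun z hz => ?_
      rw [← hartogsParam_image hg0]
      exact ⟨(z, t), ⟨hz, ht⟩, rfl⟩
    refine Eq.trans ?_ (integral_radial_mul_eq_zero (ρ := fun r => (ρ r : ℂ))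
      (Complex.continuous_ofReal.comp hρ) hH h0)
    refine setIntegral_congr_fun measurableSet_ball fun z hz => ?_
    have h1 := hg0 z hz
    have h2 : (starRingEnd ℂ) (g z) ≠ 0 := by simpa using h1
    have h3 : ((‖g z‖ : ℂ)) ^ 2 = (starRingEnd ℂ) (g z) * g z := by
      rw [mul_comm, Complex.mul_conj, Complex.normSq_eq_norm_sq]; push_cast; rfl
    simp only [hartogsFun, hartogsParam, Complex.real_smul, map_mul, map_inv₀, map_pow,
      Complex.conj_ofReal, Complex.ofReal_pow]
    rw [h3]
    field_simp
  · exact integral_undef hi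

/-- The Bergman projection of a radial multiple of `z₂ / g(z₁)²` is a constant multiple of it. -/
theorem bergmanProjection_radial_hartogsFun {g : ℂ → ℂ} (hg : DifferentiableOn ℂ g (ball 0 1))
    (hg0 : ∀ z ∈ ball (0 : ℂ) 1, g z ≠ 0) {χ : ℝ → ℝ} (hχ : Continuous χ) {c : ℝ}
    (hc : ∫ z in ball (0 : ℂ) 1, ((χ ‖z‖ - c : ℝ) : ℂ) = 0) (f : L2 (hartogsDomain g))
    (hf : f =ᵐ[volume.restrict (hartogsDomain g)] fun z => χ ‖z.1‖ * hartogsFun g z) :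
    bergmanProjection (hartogsDomain g) f =ᵐ[volume.restrict (hartogsDomain g)]
      fun z => c * hartogsFun g z := by
  have hm : MemLp (fun z => c * hartogsFun g z) 2 (volume.restrict (hartogsDomain g)) :=
    (memLp_hartogsFun hg hg0).const_mul (c : ℂ)
  have heq : bergmanProjection (hartogsDomain g) f = hm.toLp := by
    refine Submodule.eq_starProjection_of_mem_orthogonal ?_ ?_
    · exact Submodule.le_topologicalClosure _ ⟨_,
        (differentiableOn_hartogsFun hg hg0).const_mul (c : ℂ), hm.coeFn_toLp⟩
    -- The difference of f and c h is (χ - c) h, and χ - c has mean zero.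
    · rw [Submodule.orthogonal_closure, Submodule.mem_orthogonal']
      rintro G ⟨F, hF, hGF⟩
      rw [L2.inner_def]
      refine Eq.trans (integral_congr_ae ?_) (integral_radial_hartogsFun_mul_eq_zero hg hg0
        (hχ.sub continuous_const) hc hF)
      filter_upwards [hGF, hf, hm.coeFn_toLp, Lp.coeFn_sub f hm.toLp] with z h1 h2 h3 h4
      rw [h4, Pi.sub_apply, h1, h2, h3, RCLike.inner_apply, mul_comm, ← sub_mul,
        ← Complex.ofReal_sub]
      rfl
  rw [heq]
  exact hm.coeFn_toLp

theorem contDiffOn_hartogsFun {g : ℂ → ℂ} (hg : DifferentiableOn ℂ g (ball 0 1))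
    (hg0 : ∀ z ∈ ball (0 : ℂ) 1, g z ≠ 0) :
    ContDiffOn ℝ ∞ (hartogsFun g) (hartogsDomain g) := by
  have h : ContDiffOn ℂ ∞ (fun z => (g z ^ 2)⁻¹) (ball 0 1) :=
    (differentiableOn_inv_sq hg hg0).contDiffOn isOpen_ball
  exact contDiffOn_snd.mul ((h.restrict_scalars ℝ).comp contDiffOn_fst fun _ hz => hz.1)

/-! ### The cutoff and the smoothness of the test function -/

/-- A radial cutoff function supported in the disc. -/
noncomputable def radialCutoff (r : ℝ) : ℝ := Real.smoothTransition (1 / 2 - r ^ 2)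

theorem continuous_radialCutoff : Continuous radialCutoff :=
  Real.smoothTransition.continuous.comp (by fun_prop)

/-- The cutoff depends on r only through r², hence is smooth at the origin too. -/
theorem contDiff_radialCutoff_norm : ContDiff ℝ ∞ fun z : ℂ => radialCutoff ‖z‖ :=
  Real.smoothTransition.contDiff.comp (contDiff_const.sub (contDiff_norm_sq ℝ))

/-- The constant is the mean of the cutoff, nonzero because the cutoff is nonnegative and positive
near 0. -/
theorem exists_radialCutoff_mean : ∃ c : ℝ, c ≠ 0 ∧
    ∫ z in ball (0 : ℂ) 1, ((radialCutoff ‖z‖ - c : ℝ) : ℂ) = 0 := by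
  have hcont : Continuous fun z : ℂ => radialCutoff ‖z‖ := contDiff_radialCutoff_norm.continuous
  have hint : IntegrableOn (fun z : ℂ => radialCutoff ‖z‖) (ball 0 1) :=
    (hcont.continuousOn.integrableOn_compact (isCompact_closedBall 0 1)).mono_set
      ball_subset_closedBall
  have hnn : ∀ z : ℂ, 0 ≤ radialCutoff ‖z‖ := fun z => Real.smoothTransition.nonneg _
  have hvol : 0 < volume.real (ball (0 : ℂ) 1) := by
    rw [measureReal_def, ENNReal.toReal_pos_iff]
    exact ⟨measure_ball_pos _ _ one_pos, measure_ball_lt_top⟩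
  have hpos : 0 < ∫ z in ball (0 : ℂ) 1, radialCutoff ‖z‖ := by
    rw [setIntegral_pos_iff_support_of_nonneg_ae (Filter.Eventually.of_forall hnn) hint]
    refine lt_of_lt_of_le (measure_ball_pos volume (0 : ℂ) (r := 1 / 2) (by norm_num))
      (measure_mono fun z hz => ⟨?_, ball_subset_ball (by norm_num) hz⟩)
    rw [mem_ball_zero_iff] at hz
    refine (Real.smoothTransition.pos_of_pos ?_).ne'
    nlinarith [norm_nonneg z]
  refine ⟨(volume.real (ball (0 : ℂ) 1))⁻¹ * ∫ z in ball (0 : ℂ) 1, radialCutoff ‖z‖,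
    (mul_pos (inv_pos.2 hvol) hpos).ne', ?_⟩
  rw [integral_complex_ofReal, integral_sub hint (integrableOn_const measure_ball_lt_top.ne),
    setIntegral_const, smul_eq_mul, mul_inv_cancel_left₀ hvol.ne', sub_self, Complex.ofReal_zero]

/-- The cutoff vanishes where |z|² ≥ 1/2, so the values of g near or beyond the unit circle do not
matter. -/
theorem contDiff_radialCutoff_mul_inv_sq {g : ℂ → ℂ} (hg : DifferentiableOn ℂ g (ball 0 1))
    (hg0 : ∀ z ∈ ball (0 : ℂ) 1, g z ≠ 0) :
    ContDiff ℝ ∞ fun z : ℂ => (radialCutoff ‖z‖ : ℂ) * (g z ^ 2)⁻¹ := by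
  rw [contDiff_iff_contDiffAt]
  intro z
  by_cases hz : ‖z‖ < 1
  · have h : ContDiffAt ℂ ∞ (fun z => (g z ^ 2)⁻¹) z :=
      ((differentiableOn_inv_sq hg hg0).contDiffOn isOpen_ball).contDiffAt
        (isOpen_ball.mem_nhds (by simpa using hz))
    exact (Complex.ofRealCLM.contDiff.comp contDiff_radialCutoff_norm).contDiffAt.mul
      (h.restrict_scalars ℝ)
  · have hev : ∀ᶠ y : ℂ in nhds z, (radialCutoff ‖y‖ : ℂ) * (g y ^ 2)⁻¹ = 0 := by
      have : ∀ᶠ y : ℂ in nhds z, 1 / 2 - ‖y‖ ^ 2 < 0 :=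
        (by fun_prop : Continuous fun y : ℂ => 1 / 2 - ‖y‖ ^ 2).continuousAt.eventually_lt_const
          (by nlinarith)
      filter_upwards [this] with y hy
      rw [radialCutoff, Real.smoothTransition.zero_of_nonpos hy.le]
      simp
    exact contDiffAt_const.congr_of_eventuallyEq hev

/-- The function is smooth on all of ℂ², and the domain lies in a compact set. -/
theorem memSmoothBounded_radialCutoff_hartogsFun {g : ℂ → ℂ}
    (hg : DifferentiableOn ℂ g (ball 0 1)) (hg0 : ∀ z ∈ ball (0 : ℂ) 1, g z ≠ 0) {M : ℝ}
    (hM : ∀ z ∈ ball (0 : ℂ) 1, ‖g z‖ ≤ M) :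
    MemSmoothBounded (hartogsDomain g) fun z => radialCutoff ‖z.1‖ * hartogsFun g z := by
  have hsm : ContDiff ℝ ∞ fun z : ℂ × ℂ => (radialCutoff ‖z.1‖ : ℂ) * hartogsFun g z := by
    have e : (fun z : ℂ × ℂ => (radialCutoff ‖z.1‖ : ℂ) * hartogsFun g z) =
        fun z => z.2 * ((radialCutoff ‖z.1‖ : ℂ) * (g z.1 ^ 2)⁻¹) := by
      ext z; simp only [hartogsFun]; ring
    rw [e]
    exact contDiff_snd.mul ((contDiff_radialCutoff_mul_inv_sq hg hg0).comp contDiff_fst)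
  refine ⟨hsm.contDiffOn, fun j w => ?_⟩
  have hc : Continuous (partialDeriv w fun z : ℂ × ℂ => (radialCutoff ‖z.1‖ : ℂ) * hartogsFun g z) :=
    continuous_iff_continuousAt.2 fun z =>
      (contDiffAt_partialDeriv w hsm.contDiffAt).continuousAt
  obtain ⟨B, hB⟩ := ((isCompact_closedBall (0 : ℂ) 1).prod
    (isCompact_closedBall (0 : ℂ) M)).exists_bound_of_continuousOn hc.continuousOn
  exact ⟨B, fun z hz => hB z (hartogsDomain_subset hM hz)⟩

/-! ### From Sobolev regularity of the projection to the boundary behaviour of g -/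

theorem fderiv_comp_fst_apply {v : ℂ → ℂ} {z : ℂ × ℂ} (hv : DifferentiableAt ℂ v z.1)
    (c : ℂ) : fderiv ℝ (fun z : ℂ × ℂ => c * v z.1) z (1, 0) = c * deriv v z.1 := by
  have h1 : HasFDerivAt (fun z : ℂ × ℂ => v z.1) (deriv v z.1 • ContinuousLinearMap.fst ℂ ℂ ℂ) z :=
    hv.hasDerivAt.comp_hasFDerivAt z hasFDerivAt_fst
  rw [((h1.const_mul c).restrictScalars ℝ).fderiv]
  simp

theorem fderiv_snd_mul_comp_fst_apply {v : ℂ → ℂ} {z : ℂ × ℂ} (hv : DifferentiableAt ℂ v z.1)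
    (c : ℂ) : fderiv ℝ (fun z : ℂ × ℂ => c * (z.2 * v z.1)) z (0, 1) = c * v z.1 := by
  have h1 : HasFDerivAt (fun z : ℂ × ℂ => v z.1) (deriv v z.1 • ContinuousLinearMap.fst ℂ ℂ ℂ) z :=
    hv.hasDerivAt.comp_hasFDerivAt z hasFDerivAt_fst
  have h2 : HasFDerivAt (fun z : ℂ × ℂ => z.2) (ContinuousLinearMap.snd ℂ ℂ ℂ) z := hasFDerivAt_snd
  have h3 : HasFDerivAt (fun z : ℂ × ℂ => c * (z.2 * v z.1)) _ z := (h2.mul h1).const_mul c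
  rw [(h3.restrictScalars ℝ).fderiv]
  simp

theorem differentiableOn_iteratedDeriv {u : ℂ → ℂ} {s : Set ℂ} (hs : IsOpen s)
    (hu : DifferentiableOn ℂ u s) (a : ℕ) : DifferentiableOn ℂ (iteratedDeriv a u) s := by
  induction a with
  | zero => simpa using hu
  | succ a ih => rw [iteratedDeriv_succ]; exact ih.deriv hs

/-- The mixed derivatives `∂₁ᵃ ∂₂` of `z₂ / g(z₁)²`. -/
theorem exists_partialDeriv_hartogsFun {g : ℂ → ℂ} (hg : DifferentiableOn ℂ g (ball 0 1))
    (hg0 : ∀ z ∈ ball (0 : ℂ) 1, g z ≠ 0) (c : ℂ) (a : ℕ) :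
    ∃ w : Fin (a + 1) → Fin 4, ∀ z ∈ hartogsDomain g,
      partialDeriv w (fun z => c * hartogsFun g z) z =
        c * iteratedDeriv a (fun z => (g z ^ 2)⁻¹) z.1 := by
  have hΩ := isOpen_hartogsDomain hg hg0
  have hu := differentiableOn_inv_sq hg hg0
  have hsm : ∀ z ∈ hartogsDomain g, ContDiffAt ℝ ∞ (fun z => c * hartogsFun g z) z := fun z hz =>
    (contDiffOn_const.mul (contDiffOn_hartogsFun hg hg0)).contDiffAt (hΩ.mem_nhds hz)
  induction a with
  | zero =>
    -- Directions 2 and 0 are those of Re z₂ and Re z₁; on holomorphic functions these real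
    -- derivatives are the complex ones.
    refine ⟨![2], fun z hz => ?_⟩
    rw [partialDeriv_succ_left _ (hsm z hz)]
    have h0 : partialDeriv (Fin.tail ![2]) (fun z => c * hartogsFun g z) =
        fun z => c * (z.2 * (g z.1 ^ 2)⁻¹) := by
      ext z; simp [partialDeriv, hartogsFun]
    rw [h0]
    have := fderiv_snd_mul_comp_fst_apply (hu.differentiableAt (isOpen_ball.mem_nhds hz.1)) c
    simpa [coordDir] using this
  | succ a ih =>
    obtain ⟨w, hw⟩ := ih
    refine ⟨Fin.cons 0 w, fun z hz => ?_⟩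
    rw [partialDeriv_succ_left _ (hsm z hz), Fin.tail_cons, Fin.cons_zero]
    have hev : partialDeriv w (fun z => c * hartogsFun g z) =ᶠ[nhds z]
        fun z => c * iteratedDeriv a (fun z => (g z ^ 2)⁻¹) z.1 := by
      filter_upwards [hΩ.mem_nhds hz] with y hy using hw y hy
    rw [hev.fderiv_eq, iteratedDeriv_succ]
    exact fderiv_comp_fst_apply ((differentiableOn_iteratedDeriv isOpen_ball hu a).differentiableAt
      (isOpen_ball.mem_nhds hz.1)) c

/-- A square integrable function of `z₁` on the Hartogs domain is square integrable on the disc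
with respect to the weight `|g|²`. -/
theorem memLp_mul_of_memLp_comp_fst {g v : ℂ → ℂ} (hg : DifferentiableOn ℂ g (ball 0 1))
    (hg0 : ∀ z ∈ ball (0 : ℂ) 1, g z ≠ 0) (hv : DifferentiableOn ℂ v (ball 0 1))
    (h : MemLp (fun z : ℂ × ℂ => v z.1) 2 (volume.restrict (hartogsDomain g))) :
    MemLp (fun z => v z * g z) 2 (volume.restrict (ball 0 1)) := by
  have hmeas : AEStronglyMeasurable (fun z => v z * g z) (volume.restrict (ball 0 1)) :=
    (hv.mul hg).continuousOn.aestronglyMeasurable measurableSet_ball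
  rw [memLp_two_iff_integrable_sq_norm hmeas]
  have h1 : IntegrableOn (fun z : ℂ × ℂ => ‖v z.1‖ ^ 2) (hartogsDomain g) := h.integrable_norm_pow
    two_ne_zero
  rw [integrableOn_hartogsDomain_iff hg hg0, IntegrableOn, Measure.volume_eq_prod,
    ← Measure.prod_restrict] at h1
  have h2 := h1.prod_left_ae
  have : (ae (volume.restrict (ball (0 : ℂ) 1))).NeBot := by
    rw [ae_restrict_neBot]
    exact (measure_ball_pos _ _ one_pos).ne'
  -- The pulled-back integrand is the same for every t, so one integrable slice suffices.
  obtain ⟨t, ht⟩ := h2.exists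
  refine ht.congr (Filter.Eventually.of_forall fun z => ?_)
  simp only [hartogsParam, smul_eq_mul, norm_mul]
  ring

/-- If the Bergman projection preserves the regularity of the cutoff of `z₂ / g(z₁)²`, then the
closure of the Hartogs domain has a Stein neighborhood basis. -/
theorem hasSteinNeighborhoodBasis_of_memSobolev {g : ℂ → ℂ}
    (hg : DifferentiableOn ℂ g (ball 0 1)) (hg0 : ∀ z ∈ ball (0 : ℂ) 1, g z ≠ 0) {M : ℝ}
    (hM : ∀ z ∈ ball (0 : ℂ) 1, ‖g z‖ ≤ M)
    (h : ∀ f : L2 (hartogsDomain g),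
      f =ᵐ[volume.restrict (hartogsDomain g)] (fun z => radialCutoff ‖z.1‖ * hartogsFun g z) →
      MemSobolev (hartogsDomain g) 4 (bergmanProjection (hartogsDomain g) f)) :
    HasSteinNeighborhoodBasis (closure (hartogsDomain g)) := by
  have hΩ := isOpen_hartogsDomain hg hg0
  have hu := differentiableOn_inv_sq hg hg0
  set u : ℂ → ℂ := fun z => (g z ^ 2)⁻¹ with hu_def
  obtain ⟨c, hc0, hc⟩ := exists_radialCutoff_mean
  have hc0' : (c : ℂ) ≠ 0 := by exact_mod_cast hc0
  have hvol : volume (hartogsDomain g) ≠ ⊤ := ((measure_mono (hartogsDomain_subset hM)).trans_lt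
    ((isCompact_closedBall 0 1).prod (isCompact_closedBall 0 M)).measure_lt_top).ne
  have hm := ((memSmoothBounded_radialCutoff_hartogsFun hg hg0 hM).memSobolev hΩ hvol 0).1
  have hS : MemSobolev (hartogsDomain g) 4 fun z => c * hartogsFun g z :=
    (h hm.toLp hm.coeFn_toLp).congr_ae (bergmanProjection_radial_hartogsFun hg hg0
      continuous_radialCutoff hc _ hm.coeFn_toLp)
  have hsm : ContDiffOn ℝ ∞ (fun z => c * hartogsFun g z) (hartogsDomain g) :=
    contDiffOn_const.mul (contDiffOn_hartogsFun hg hg0)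
  have hL2 : ∀ a ≤ 3, MemLp (fun z => iteratedDeriv a u z * g z) 2
      (volume.restrict (ball 0 1)) := by
    intro a ha
    obtain ⟨w, hw⟩ := exists_partialDeriv_hartogsFun hg hg0 c a
    -- One derivative in z₂ and a ≤ 3 in z₁ make order at most 4. Reversing w here cancels the
    -- reversal in `hasWeakDeriv_partialDeriv`.
    obtain ⟨v, hv, hv2⟩ := hS.2 (a + 1) (by omega) (w ∘ Fin.rev)
    have hv' := hasWeakDeriv_partialDeriv hΩ hsm (w ∘ Fin.rev)
    have hrev : (w ∘ Fin.rev) ∘ Fin.rev = w := by ext i; simp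
    rw [hrev] at hv'
    have hae := HasWeakDeriv.ae_unique hΩ hv hv'
    refine memLp_mul_of_memLp_comp_fst hg hg0 (differentiableOn_iteratedDeriv isOpen_ball hu a) ?_
    refine (hv2.const_mul (c : ℂ)⁻¹).ae_eq ?_
    filter_upwards [hae, ae_restrict_mem hΩ.measurableSet] with z h1 h2
    rw [h1, hw z h2, inv_mul_cancel_left₀ hc0']
  have hint : IntegrableOn (iteratedDeriv 3 u) (ball 0 1) := by
    -- By Cauchy–Schwarz (u‴ g)(u g) is integrable, and u g² = 1.
    have h1 := (hL2 3 le_rfl).integrable_mul (hL2 0 (by norm_num))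
    refine IntegrableOn.congr_fun h1 (fun z hz => ?_) measurableSet_ball
    have := hg0 z hz
    simp only [Pi.mul_apply, iteratedDeriv_zero, hu_def]
    field_simp
  obtain ⟨V, hVc, hVu⟩ := exists_continuousOn_extension_of_integrableOn hu hint
  have hM0 : 0 < M := (norm_pos_iff.2 (hg0 0 (by simp))).trans_le (hM 0 (by simp))
  -- Boundedness of g enters here: |u| = |g|⁻² ≥ M⁻² on the disc, and the bound passes to the
  -- closure by continuity. It keeps the radius function (√|V|)⁻¹ finite and continuous at the
  -- boundary.
  have hVlow : ∀ z ∈ closedBall (0 : ℂ) 1, (M ^ 2)⁻¹ ≤ ‖V z‖ := by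
    rw [← closure_ball (0 : ℂ) one_ne_zero] at hVc ⊢
    intro z hz
    refine le_on_closure (f := fun _ => (M ^ 2)⁻¹) (g := fun z => ‖V z‖) (fun y hy => ?_)
      continuousOn_const hVc.norm hz
    have h1 := norm_pos_iff.2 (hg0 y hy)
    have h2 := hM y hy
    simp only [hVu y hy, hu_def, norm_inv, norm_pow]
    gcongr
  have hVpos : ∀ z ∈ closedBall (0 : ℂ) 1, 0 < ‖V z‖ := fun z hz =>
    lt_of_lt_of_le (by positivity) (hVlow z hz)
  refine hasSteinNeighborhoodBasis_of_continuous_extension hg hg0 (ψ := fun z => (√‖V z‖)⁻¹)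
    ?_ ?_ ?_
  · exact (Real.continuous_sqrt.comp_continuousOn hVc.norm).inv₀ fun z hz =>
      (Real.sqrt_pos.2 (hVpos z hz)).ne'
  · exact fun z hz => inv_pos.2 (Real.sqrt_pos.2 (hVpos z hz))
  · intro z hz
    simp only [hVu z hz, hu_def, norm_inv, norm_pow]
    rw [Real.sqrt_inv, Real.sqrt_sq (norm_nonneg _), inv_inv]

theorem theorem1p4 (g : ℂ → ℂ)
    (hg : DifferentiableOn ℂ g (Metric.ball 0 1))
    (hnonconst : ¬ ∃ c : ℂ, ∀ z ∈ Metric.ball (0 : ℂ) 1, g z = c)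
    (hnonvan : ∀ z ∈ Metric.ball (0 : ℂ) 1, g z ≠ 0)
    (hbdd : ∃ M : ℝ, ∀ z ∈ Metric.ball (0 : ℂ) 1, ‖g z‖ ≤ M) :
    ((∀ k : ℕ, BergmanBoundedOnSobolev (hartogsDomain g) k) →
      HasSteinNeighborhoodBasis (closure (hartogsDomain g))) ∧
    (BergmanContinuousOnSmooth (hartogsDomain g) →
      HasSteinNeighborhoodBasis (closure (hartogsDomain g))) := by
  obtain ⟨M, hM⟩ := hbdd
  have hΩ := isOpen_hartogsDomain hg hnonvan
  have hvol : volume (hartogsDomain g) ≠ ⊤ := ((measure_mono (hartogsDomain_subset hM)).trans_lt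
    ((isCompact_closedBall 0 1).prod (isCompact_closedBall 0 M)).measure_lt_top).ne
  have hf := memSmoothBounded_radialCutoff_hartogsFun hg hnonvan hM
  refine ⟨fun h => ?_, fun h => ?_⟩
  · obtain ⟨C, hC⟩ := h 4
    exact hasSteinNeighborhoodBasis_of_memSobolev hg hnonvan hM fun f hfe =>
      (hC f ((hf.memSobolev hΩ hvol 4).congr_ae hfe.symm)).1
  · refine hasSteinNeighborhoodBasis_of_memSobolev hg hnonvan hM fun f hfe => ?_
    obtain ⟨F, hF, hFe⟩ := h.1 _ f hf hfe
    exact (hF.memSobolev hΩ hvol 4).congr_ae hFe.symm
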